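/- Let $G$ be a countable discrete group acting on a nonzero unital $C^*$-algebra $P$ through $\sigma : G\to \mathrm{Aut}(P)$, and let $H, K, L$ be subgroups of $G$ with $[G:H]<\infty$ and $H\subsetneq K\subsetneq G$, $H\subsetneq L\subsetneq G$. Let $A$ be the reduced crossed product $P\rtimes_{\sigma,r}G$ or the universal crossed product $P\rtimes_\sigma G$, i.e. the completion of the $*$-algebra $C_c(G,P)$ of finite sums $\sum a_g g$ in the reduced (resp. universal) norm. For a subgroup $M\le G$ let $A_M\subseteq A$ denote the corresponding crossed product of $P$ by $M$, identified with the closure of $C_c(M,P)$ in $A$, and put $B=A_H$, $C=A_K$, $D=A_L$ and $C_g=A_{g^{-1}Kg}$ for $g\in G$. There is a conditional expectation $E:A\to B$ with $E\big(\sum_{g\in G} a_g g\big)=\sum_{h\in H}a_h h$ on $C_c(G,P)$; any such $E$ has finite index, that is, there are $\lambda_1,\dots,\lambda_n\in A$ with $x=\sum_i E(x\lambda_i)\lambda_i^*=\sum_i\lambda_iE(\lambda_i^*x)$ for all $x\in A$. Write $\mathrm{Ind}(E)=\sum_i\lambda_i\lambda_i^*$, let $e_B$ be $E$ regarded as an operator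 on the Hilbert $B$-module $A$ with $\langle x,y\rangle_B=E(x^*y)$, let $A_1=\mathrm{span}\{xe_By: x,y\in A\}$ with $A$ acting by left multiplication, and let $E_1:A_1\to A$ be the linear map with $E_1(xe_By)=\mathrm{Ind}(E)^{-1}xy$. Let $\mathrm{IMS}(B,A,E)$ be the set of intermediate $C^*$-algebras $B\subseteq Q\subseteq A$ that admit a conditional expectation $F_Q:A\to Q$ with $E=E|_Q\circ F_Q$; for such $Q$ let $e_Q\in A_1$ be $F_Q$ regarded as an operator on $A$. For $Q,R\in \mathrm{IMS}(B,A,E)\setminus\{B\}$ the interior angle $\alpha(Q,R)\in[0,\frac{\pi}{2}]$ is defined by $$\cos\alpha(Q,R)=\frac{\|E_1\big((e_Q-e_B)^*(e_R-e_B)\big)\|}{\|E_1\big((e_Q-e_B)^*(e_Q-e_B)\big)\|^{1/2}\,\|E_1\big((e_R-e_B)^*(e_R-e_B)\big)\|^{1/2}}.$$ Then $C,D\in \mathrm{IMS}(B,A,E)\setminus\{B\}$, and 1. $\alpha(C,D)=\frac{\pi}{2}$ if and only if $K\cap L=H$; 2. $\alpha(C,D)=0$ if and only if $K=L$. In particular,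 $K$ is normal in $G$ if and only if, for every $g\in G$, $C_g\in\mathrm{IMS}(B,A,E)\setminus\{B\}$ (so that $\alpha(C,C_g)$ is defined) and $\alpha(C,C_g)=0$. -/

import Mathlib

universe u v w

noncomputable section

namespace WatataniAngle

/-! ### Conditional expectations of finite index -/

/-- A conditional expectation of the unital `C*`-algebra `A` onto the unital subalgebra `B`,
seen as a map `A → A` with values in `B`: a positive contractive `B`-bimodule projection. -/
structure CondExp {A : Type*} [CStarAlgebra A] (B : StarSubalgebra ℂ A) where
  toMap : A →ₗ[ℂ] A
  map_mem : ∀ a, toMap a ∈ B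
  map_of_mem : ∀ b ∈ B, toMap b = b
  map_mul_mul : ∀ b ∈ B, ∀ c ∈ B, ∀ a, toMap (b * a * c) = b * toMap a * c
  map_star_mul_self : ∀ a, ∃ c, toMap (star a * a) = star c * c
  norm_map_le : ∀ a, ‖toMap a‖ ≤ ‖a‖

namespace CondExp

variable {A : Type*} [CStarAlgebra A] {B : StarSubalgebra ℂ A} (E : CondExp B)

theorem map_mul_left {b : A} (hb : b ∈ B) (a : A) : E.toMap (b * a) = b * E.toMap a := by
  simpa using E.map_mul_mul b hb 1 B.one_mem a

theorem map_mul_right {b : A} (hb : b ∈ B) (a : A) : E.toMap (a * b) = E.toMap a * b := by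
  simpa using E.map_mul_mul 1 B.one_mem b hb a

theorem map_star (a : A) : E.toMap (star a) = star (E.toMap a) := by
  have sa : ∀ x : A, star (E.toMap (star x * x)) = E.toMap (star x * x) := fun x => by
    obtain ⟨c, hc⟩ := E.map_star_mul_self x
    rw [hc]; simp
  have h1 := sa (1 + a)
  have h2 := sa (1 + Complex.I • a)
  have h3 := sa a
  have e1 : star (1 + a) * (1 + a) = 1 + a + star a + star a * a := by
    simp only [star_add, star_one]; noncomm_ring
  have e2 : star (1 + Complex.I • a) * (1 + Complex.I • a)
      = 1 + Complex.I • a - Complex.I • star a + star a * a := by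
    simp only [star_add, star_one, star_smul, Complex.star_def, Complex.conj_I, add_mul, mul_add,
      one_mul, mul_one, neg_smul, smul_mul_smul_comm, neg_mul, Complex.I_mul_I, neg_neg, one_smul]
    abel
  have e0 : E.toMap 1 = 1 := E.map_of_mem 1 B.one_mem
  rw [e1] at h1
  rw [e2] at h2
  simp only [map_add, map_sub, map_smul, star_add, star_sub, star_smul, e0, star_one, h3,
    Complex.star_def, Complex.conj_I, neg_smul] at h1 h2
  have h1' : star (E.toMap a) + star (E.toMap (star a)) = E.toMap a + E.toMap (star a) := by
    have := congrArg (fun z => z - 1 - E.toMap (star a * a)) h1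
    simpa [add_sub_cancel_right, add_assoc, add_sub_assoc, sub_eq_add_neg, add_comm, add_left_comm]
      using this
  have h2' : -star (E.toMap a) + star (E.toMap (star a)) = E.toMap a - E.toMap (star a) := by
    have h4 : Complex.I • (-star (E.toMap a) + star (E.toMap (star a)))
        = Complex.I • (E.toMap a - E.toMap (star a)) := by
      rw [smul_add, smul_neg, smul_sub]
      have := congrArg (fun z => z - 1 - E.toMap (star a * a)) h2
      calc _ = 1 + -(Complex.I • star (E.toMap a)) - -(Complex.I • star (E.toMap (star a))) +
            E.toMap (star a * a) - 1 - E.toMap (star a * a) := by abel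
        _ = _ := this
        _ = _ := by abel
    exact smul_right_injective A Complex.I_ne_zero h4
  have h5 : (2 : ℂ) • E.toMap (star a) = (2 : ℂ) • star (E.toMap a) := by
    rw [two_smul, two_smul]
    calc _ = (E.toMap a + E.toMap (star a)) - (E.toMap a - E.toMap (star a)) := by abel
      _ = _ := by rw [← h1', ← h2']; abel
  exact smul_right_injective A (two_ne_zero) h5

/-- `lam` is a quasi-basis for `E`. -/
def IsQuasiBasis {n : ℕ} (lam : Fin n → A) : Prop :=
  ∀ x, x = ∑ i, E.toMap (x * lam i) * star (lam i) ∧ x = ∑ i, lam i * E.toMap (star (lam i) * x)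

/-- `E` has finite index. -/
def HasFiniteIndex : Prop := ∃ n, ∃ lam : Fin n → A, E.IsQuasiBasis lam

variable {E}

/-- A quasi-basis, chosen once and for all. -/
def HasFiniteIndex.quasiBasis (hE : E.HasFiniteIndex) : Fin hE.choose → A := hE.choose_spec.choose

theorem HasFiniteIndex.isQuasiBasis (hE : E.HasFiniteIndex) : E.IsQuasiBasis hE.quasiBasis :=
  hE.choose_spec.choose_spec

/-- The Watatani index `Ind(E) = ∑ lamᵢ lamᵢ*`. -/
def index (hE : E.HasFiniteIndex) : A := ∑ i, hE.quasiBasis i * star (hE.quasiBasis i)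

/-- The index does not depend on the quasi-basis. -/
theorem index_eq (hE : E.HasFiniteIndex) {n : ℕ} {mu : Fin n → A} (hmu : E.IsQuasiBasis mu) :
    index hE = ∑ j, mu j * star (mu j) := by
  have h1 : ∀ i, hE.quasiBasis i * star (hE.quasiBasis i) = ∑ j, mu j *
      (E.toMap (star (mu j) * hE.quasiBasis i) * star (hE.quasiBasis i)) := fun i => by
    conv_lhs => rw [(hmu (hE.quasiBasis i)).2]
    simp only [Finset.sum_mul, mul_assoc]
    rw [← (hmu (hE.quasiBasis i)).2]
  rw [index, Finset.sum_congr rfl fun i _ => h1 i, Finset.sum_comm]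
  refine Finset.sum_congr rfl fun j _ => ?_
  rw [← Finset.mul_sum, ← (hE.isQuasiBasis (star (mu j))).1]

/-! ### The basic construction

For `E` of finite index, `A` with `⟨x, y⟩_B = E(x* y)` is a Hilbert `B`-module, `A` acts on it by
left multiplication, the Jones projection `e_B` is `E` as an operator on `A`, and the basic
construction `A₁` is the linear span of the operators `x e_B y`. -/

variable (E)

/-- The operator `x e_B y` on `A`. -/
def opE (x y : A) : Module.End ℂ A :=
  LinearMap.mulLeft ℂ x * E.toMap * LinearMap.mulLeft ℂ y

@[simp] theorem opE_apply (x y a : A) : E.opE x y a = x * E.toMap (y * a) := rfl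

/-- The basic construction `A₁ = span {x e_B y}`. -/
def basicConstruction : Submodule ℂ (Module.End ℂ A) :=
  Submodule.span ℂ {T | ∃ x y, T = E.opE x y}

theorem opE_mem (x y : A) : E.opE x y ∈ E.basicConstruction :=
  Submodule.subset_span ⟨x, y, rfl⟩

theorem basicConstruction_mul {S T : Module.End ℂ A} (hS : S ∈ E.basicConstruction)
    (hT : T ∈ E.basicConstruction) : S * T ∈ E.basicConstruction := by
  have hm : ∀ x y x' y', E.opE x y * E.opE x' y' = E.opE (x * E.toMap (y * x')) y' := by
    intro x y x' y'
    ext a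
    simp only [Module.End.mul_apply, opE_apply]
    rw [← mul_assoc y, E.map_mul_right (E.map_mem _), mul_assoc]
  induction hS using Submodule.span_induction with
  | zero => rw [zero_mul]; exact Submodule.zero_mem _
  | add S S' _ _ h h' => rw [add_mul]; exact Submodule.add_mem _ h h'
  | smul c S _ h => rw [smul_mul_assoc]; exact Submodule.smul_mem _ c h
  | mem S hS =>
    obtain ⟨x, y, rfl⟩ := hS
    induction hT using Submodule.span_induction with
    | zero => rw [mul_zero]; exact Submodule.zero_mem _
    | add S S' _ _ h h' => rw [mul_add]; exact Submodule.add_mem _ h h'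
    | smul c S _ h => rw [mul_smul_comm]; exact Submodule.smul_mem _ c h
    | mem T hT =>
      obtain ⟨x', y', rfl⟩ := hT
      rw [hm]; exact E.opE_mem _ _

/-- `S` is the adjoint of `T` for the inner product `⟨x, y⟩_B = E(x* y)`. -/
def IsAdjoint (T S : Module.End ℂ A) : Prop :=
  ∀ x y, E.toMap (star (T x) * y) = E.toMap (star x * S y)

variable {E}

theorem IsAdjoint.unique (hE : E.HasFiniteIndex) {T S S' : Module.End ℂ A}
    (h : E.IsAdjoint T S) (h' : E.IsAdjoint T S') : S = S' := by
  ext y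
  rw [(hE.isQuasiBasis (S y)).2, (hE.isQuasiBasis (S' y)).2]
  simp only [← h _ y, ← h' _ y]

theorem exists_isAdjoint (T : E.basicConstruction) :
    ∃ S : E.basicConstruction, E.IsAdjoint T.1 S.1 := by
  obtain ⟨T, hT⟩ := T
  induction hT using Submodule.span_induction with
  | zero => exact ⟨0, fun x y => by simp⟩
  | add S S' _ _ h h' =>
    obtain ⟨R, hR⟩ := h
    obtain ⟨R', hR'⟩ := h'
    refine ⟨R + R', fun x y => ?_⟩
    have h1 := hR x y
    have h2 := hR' x y
    simp only at h1 h2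
    simp [add_mul, mul_add, h1, h2]
  | smul c S _ h =>
    obtain ⟨R, hR⟩ := h
    refine ⟨star c • R, fun x y => ?_⟩
    have h1 := hR x y
    simp only at h1
    simp [h1]
  | mem S hS =>
    obtain ⟨x, y, rfl⟩ := hS
    refine ⟨⟨E.opE (star y) (star x), E.opE_mem _ _⟩, fun u v => ?_⟩
    simp only [opE_apply, star_mul]
    rw [mul_assoc, ← E.map_star, E.map_mul_left (E.map_mem _), ← mul_assoc,
      E.map_mul_right (E.map_mem _), star_mul]

/-- The adjoint `T*` of `T ∈ A₁`. -/
def adj (T : E.basicConstruction) : E.basicConstruction := (exists_isAdjoint T).choose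

theorem isAdjoint_adj (T : E.basicConstruction) : E.IsAdjoint T.1 (adj T).1 :=
  (exists_isAdjoint T).choose_spec

/-- The dual conditional expectation `E₁ : A₁ → A`: the linear map with
`E₁(x e_B y) = Ind(E)⁻¹ x y`, see `dualExp_opE`. -/
def dualExp (hE : E.HasFiniteIndex) : E.basicConstruction →ₗ[ℂ] A where
  toFun T := Ring.inverse (index hE) * ∑ i, T.1 (hE.quasiBasis i) * star (hE.quasiBasis i)
  map_add' S T := by simp [add_mul, mul_add, Finset.sum_add_distrib]
  map_smul' c T := by simp [← Finset.smul_sum]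

theorem dualExp_opE (hE : E.HasFiniteIndex) (x y : A) :
    dualExp hE ⟨E.opE x y, E.opE_mem x y⟩ = Ring.inverse (index hE) * (x * y) := by
  show Ring.inverse (index hE) * ∑ i, E.opE x y (hE.quasiBasis i) * star (hE.quasiBasis i) = _
  simp only [opE_apply, mul_assoc x]
  rw [← Finset.mul_sum, ← (hE.isQuasiBasis y).1]

/-- The `A`-valued inner product `⟨S, T⟩_A = E₁(S* T)` on `A₁`. -/
def innerA (hE : E.HasFiniteIndex) (S T : E.basicConstruction) : A :=
  dualExp hE ⟨(adj S).1 * T.1, E.basicConstruction_mul (adj S).2 T.2⟩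

/-- The norm `‖T‖_{A₁} = ‖E₁(T* T)‖^{1/2}` on `A₁`. -/
def normA (hE : E.HasFiniteIndex) (T : E.basicConstruction) : ℝ := √‖innerA hE T T‖

/-! ### Intermediate subalgebras and the interior angle -/

variable (E)

/-- `C ∈ IMS(B, A, E)`: an intermediate `C*`-subalgebra with a conditional expectation `F` onto it
such that `E = E|_C ∘ F`. -/
def IsIMS (C : StarSubalgebra ℂ A) : Prop :=
  B ≤ C ∧ IsClosed (C : Set A) ∧ ∃ F : CondExp C, ∀ a, E.toMap a = E.toMap (F.toMap a)

/-- The Jones projection `e_B`. -/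
def jonesB : E.basicConstruction :=
  ⟨E.toMap, by
    have : E.toMap = E.opE 1 1 := by ext a; simp
    rw [this]; exact E.opE_mem _ _⟩

variable {E}

theorem compatible_mem (hE : E.HasFiniteIndex) {C : StarSubalgebra ℂ A} (hBC : B ≤ C)
    (F : CondExp C) (hF : ∀ a, E.toMap a = E.toMap (F.toMap a)) :
    F.toMap ∈ E.basicConstruction := by
  have : F.toMap = ∑ i, E.opE (F.toMap (hE.quasiBasis i)) (F.toMap (star (hE.quasiBasis i))) := by
    ext a
    rw [LinearMap.sum_apply]
    have h1 := congrArg F.toMap (hE.isQuasiBasis (F.toMap a)).2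
    rw [F.map_of_mem _ (F.map_mem a), map_sum] at h1
    rw [h1]
    refine Finset.sum_congr rfl fun i _ => ?_
    rw [F.map_mul_right (hBC (E.map_mem _)), opE_apply, hF (star _ * F.toMap a),
      F.map_mul_right (F.map_mem a), hF (F.toMap (star _) * a), F.map_mul_left (F.map_mem _)]
  rw [this]
  exact Submodule.sum_mem _ fun i _ => E.opE_mem _ _

/-- The Jones projection `e_C ∈ A₁` of `C ∈ IMS(B, A, E)`: the compatible conditional expectation
onto `C`, as an operator on `A`. -/
def jonesC (hE : E.HasFiniteIndex) {C : StarSubalgebra ℂ A} (hC : E.IsIMS C) :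
    E.basicConstruction :=
  ⟨hC.2.2.choose.toMap, compatible_mem hE hC.1 _ hC.2.2.choose_spec⟩

/-- The interior angle `α(C, D)` of `C, D ∈ IMS(B, A, E)`, which is meant for `C ≠ B ≠ D`. -/
def interiorAngle (hE : E.HasFiniteIndex) {C D : StarSubalgebra ℂ A} (hC : E.IsIMS C)
    (hD : E.IsIMS D) : ℝ :=
  Real.arccos (‖innerA hE (jonesC hE hC - E.jonesB) (jonesC hE hD - E.jonesB)‖ /
    (normA hE (jonesC hE hC - E.jonesB) * normA hE (jonesC hE hD - E.jonesB)))

end CondExp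

/-! ### `C*`-seminorms on a unital `*`-algebra and their completions -/

/-- A `C*`-seminorm on a unital complex `*`-algebra. -/
structure CStarSeminorm (R : Type*) [Ring R] [StarRing R] [Algebra ℂ R] extends
    Seminorm ℂ R where
  mul_le' : ∀ x y, toFun (x * y) ≤ toFun x * toFun y
  star_mul_self' : ∀ x, toFun (star x * x) = toFun x * toFun x

namespace CStarSeminorm

section Completion

variable {R : Type*} [Ring R] [StarRing R] [Algebra ℂ R] (p : CStarSeminorm R)

theorem apply_star (x : R) : p.toSeminorm (star x) = p.toSeminorm x := by
  have key : ∀ y : R, p.toSeminorm y ≤ p.toSeminorm (star y) := fun y => by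
    rcases (apply_nonneg p.toSeminorm y).eq_or_lt with h | h
    · rw [← h]; exact apply_nonneg _ _
    · have h1 : p.toSeminorm (star y * y) = p.toSeminorm y * p.toSeminorm y := p.star_mul_self' y
      have h2 : p.toSeminorm (star y * y) ≤ p.toSeminorm (star y) * p.toSeminorm y := p.mul_le' _ _
      exact le_of_mul_le_mul_right (h1 ▸ h2) h
  refine le_antisymm ?_ (key x)
  simpa using key (star x)

/-- The algebra `R`, equipped with the seminorm `p`. -/
@[nolint unusedArguments]
def Carrier (_p : CStarSeminorm R) : Type _ := R

instance : Ring p.Carrier := inferInstanceAs (Ring R)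
instance : StarRing p.Carrier := inferInstanceAs (StarRing R)
instance : Algebra ℂ p.Carrier := inferInstanceAs (Algebra ℂ R)
instance [StarModule ℂ R] : StarModule ℂ p.Carrier := inferInstanceAs (StarModule ℂ R)

instance : SeminormedRing p.Carrier where
  __ := (inferInstance : Ring p.Carrier)
  __ := (p.toSeminorm.toAddGroupSeminorm.toSeminormedAddCommGroup : SeminormedAddCommGroup R)
  norm_mul_le := p.mul_le'

theorem norm_def (x : p.Carrier) : ‖x‖ = p.toSeminorm x := rfl

instance : NormedAlgebra ℂ p.Carrier where
  norm_smul_le c x := (map_smul_eq_mul p.toSeminorm c x).le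

instance : NormedStarGroup p.Carrier where
  norm_star_le x := (p.apply_star x).le

open UniformSpace

/-- The completion of `R` with respect to `p` (elements of seminorm zero become zero). -/
abbrev Compl : Type _ := Completion p.Carrier

theorem uniformContinuous_star : UniformContinuous (star : p.Carrier → p.Carrier) :=
  (AddMonoidHomClass.isometry_of_norm (starAddEquiv : p.Carrier ≃+ p.Carrier)
    fun x => norm_star x).uniformContinuous

instance : Star p.Compl := ⟨Completion.map star⟩

theorem coe_star (x : p.Carrier) : ((star x : p.Carrier) : p.Compl) = star (x : p.Compl) :=
  (Completion.map_coe p.uniformContinuous_star x).symm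

theorem continuous_star_compl : Continuous (star : p.Compl → p.Compl) :=
  Completion.continuous_map

instance : StarRing p.Compl where
  star_involutive x := by
    induction x using Completion.induction_on with
    | hp => exact isClosed_eq (p.continuous_star_compl.comp p.continuous_star_compl) continuous_id
    | ih x => rw [← coe_star, ← coe_star, star_star]
  star_mul x y := by
    have hs := p.continuous_star_compl
    induction x, y using Completion.induction_on₂ with
    | hp => exact isClosed_eq (by fun_prop) (by fun_prop)
    | ih x y => simp only [← Completion.coe_mul, ← coe_star, star_mul]
  star_add x y := by
    have hs := p.continuous_star_compl
    induction x, y using Completion.induction_on₂ with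
    | hp => exact isClosed_eq (by fun_prop) (by fun_prop)
    | ih x y => simp only [← Completion.coe_add, ← coe_star, star_add]

/-- The completion is a unital `C*`-algebra. -/
instance [StarModule ℂ R] : CStarAlgebra p.Compl where
  norm_mul_self_le x := by
    have hs := p.continuous_star_compl
    induction x using Completion.induction_on with
    | hp => exact isClosed_le (by fun_prop) (by fun_prop)
    | ih x =>
      simp only [← coe_star, ← Completion.coe_mul, Completion.norm_coe]
      exact (p.star_mul_self' x).ge
  norm_smul_le c x := norm_smul_le c x
  star_smul c x := by
    have hs := p.continuous_star_compl
    induction x using Completion.induction_on with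
    | hp => exact isClosed_eq (hs.comp (continuous_const_smul c)) ((continuous_const_smul _).comp hs)
    | ih x => rw [← Completion.coe_smul, ← coe_star, ← coe_star, ← Completion.coe_smul, star_smul]

/-- The canonical map of `R` into its completion. -/
def toCompl [StarModule ℂ R] : R →⋆ₐ[ℂ] p.Compl where
  toFun x := Completion.coe' (α := p.Carrier) x
  map_one' := rfl
  map_mul' x y := Completion.coe_mul (α := p.Carrier) x y
  map_zero' := rfl
  map_add' x y := Completion.coe_add (α := p.Carrier) x y
  commutes' _ := rfl
  map_star' x := p.coe_star x

theorem norm_toCompl [StarModule ℂ R] (x : R) : ‖p.toCompl x‖ = p.toSeminorm x :=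
  Completion.norm_coe (E := p.Carrier) x

theorem denseRange_toCompl [StarModule ℂ R] : DenseRange p.toCompl :=
  Completion.denseRange_coe (α := p.Carrier)

end Completion

/-- The `C*`-seminorm `x ↦ ‖π x‖` of a `*`-representation on a Hilbert space. -/
def ofRep {R : Type*} [Ring R] [StarRing R] [Algebra ℂ R] {V : Type*} [NormedAddCommGroup V]
    [InnerProductSpace ℂ V] [CompleteSpace V] (π : R →⋆ₐ[ℂ] (V →L[ℂ] V)) : CStarSeminorm R where
  toFun x := ‖π x‖
  map_zero' := by simp
  add_le' x y := by rw [map_add]; exact norm_add_le _ _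
  neg' x := by rw [map_neg, norm_neg]
  smul' c x := by rw [map_smul, norm_smul]
  mul_le' x y := by rw [map_mul]; exact norm_mul_le _ _
  star_mul_self' x := by rw [map_mul, map_star]; exact CStarRing.norm_star_mul_self

end CStarSeminorm

/-! ### The `*`-algebra `C_c(G, P)` and the crossed products -/

section Crossed


variable {P : Type u} [CStarAlgebra P] {G : Type v} [Group G]

/-- The `*`-algebra `C_c(G, P)` of finite sums `∑ a_g g` for an action `α` of the discrete group
`G` on `P`, with `(a s) (b t) = a α_s(b) st` and `(a s)* = α_{s⁻¹}(a*) s⁻¹`. -/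
@[nolint unusedArguments]
def Cc (_α : G →* (P ≃⋆ₐ[ℂ] P)) : Type (max u v) := SkewMonoidAlgebra P G

namespace Cc

variable (α : G →* (P ≃⋆ₐ[ℂ] P))

instance : AddCommGroup (Cc α) := inferInstanceAs (AddCommGroup (SkewMonoidAlgebra P G))

instance : Module ℂ (Cc α) := inferInstanceAs (Module ℂ (SkewMonoidAlgebra P G))

/-- The element `a g`. -/
def single (g : G) (a : P) : Cc α := SkewMonoidAlgebra.single g a

/-- The coefficient function `g ↦ a_g` of `∑ a_g g`. -/
def coeff (x : Cc α) : G →₀ P := SkewMonoidAlgebra.coeff x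

variable {α}

theorem smul_single (c : ℂ) (g : G) (a : P) : c • single α g a = single α g (c • a) :=
  SkewMonoidAlgebra.smul_single c g a

theorem single_add (g : G) (a b : P) : single α g (a + b) = single α g a + single α g b :=
  SkewMonoidAlgebra.single_add g a b

theorem single_zero (g : G) : single α g 0 = 0 := SkewMonoidAlgebra.single_zero g

@[elab_as_elim]
theorem induction_on {q : Cc α → Prop} (x : Cc α) (zero : q 0)
    (single : ∀ g a, q (single α g a)) (add : ∀ x y, q x → q y → q (x + y)) : q x :=
  SkewMonoidAlgebra.induction_on (p := q) x zero single (fun x y => add x y)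

/-- The action of `G` on `P` through `α`, in the form that `SkewMonoidAlgebra` asks for. -/
@[reducible] def action (α : G →* (P ≃⋆ₐ[ℂ] P)) : MulSemiringAction G P where
  smul g a := α g a
  one_smul a := by show α 1 a = a; simp
  mul_smul g h a := by show α (g * h) a = α g (α h a); simp
  smul_zero g := map_zero (α g)
  smul_add g := map_add (α g)
  smul_one g := map_one (α g)
  smul_mul g := map_mul (α g)

/-- The skew group ring. -/
@[reducible] def skewRing (α : G →* (P ≃⋆ₐ[ℂ] P)) : Ring (SkewMonoidAlgebra P G) :=
  @SkewMonoidAlgebra.instRing P G _ _ (action α)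

instance : Ring (Cc α) where
  __ := (inferInstance : AddCommGroup (Cc α))
  mul := (skewRing α).mul
  one := (skewRing α).one
  left_distrib := (skewRing α).left_distrib
  right_distrib := (skewRing α).right_distrib
  zero_mul := (skewRing α).zero_mul
  mul_zero := (skewRing α).mul_zero
  mul_assoc := (skewRing α).mul_assoc
  one_mul := (skewRing α).one_mul
  mul_one := (skewRing α).mul_one

theorem single_mul_single (g h : G) (a b : P) :
    single α g a * single α h b = single α (g * h) (a * α g b) :=
  @SkewMonoidAlgebra.single_mul_single P G _ _ (action α) g h a b

theorem one_def : (1 : Cc α) = single α 1 1 := rfl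

instance : Algebra ℂ (Cc α) := Algebra.ofModule
  (fun c x y => by
    induction x using induction_on with
    | zero => simp only [smul_zero, zero_mul]
    | add x x' hx hx' => simp only [smul_add, add_mul, hx, hx']
    | single g a =>
      induction y using induction_on with
      | zero => simp only [smul_zero, mul_zero]
      | add y y' hy hy' => simp only [smul_add, mul_add, hy, hy']
      | single h b => simp only [smul_single, single_mul_single, smul_mul_assoc])
  (fun c x y => by
    induction x using induction_on with
    | zero => simp only [smul_zero, zero_mul]
    | add x x' hx hx' => simp only [smul_add, add_mul, hx, hx']
    | single g a =>
      induction y using induction_on with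
      | zero => simp only [smul_zero, mul_zero]
      | add y y' hy hy' => simp only [smul_add, mul_add, hy, hy']
      | single h b => simp only [smul_single, single_mul_single, map_smul, mul_smul_comm])

variable (α) in
/-- The involution as an additive map. -/
def starAddHom : Cc α →+ Cc α :=
  (Finsupp.liftAddHom fun g : G =>
    { toFun := fun a : P => single α g⁻¹ (α g⁻¹ (star a))
      map_zero' := by simp [single_zero]
      map_add' := fun a b => by simp [single_add] }).comp
    (SkewMonoidAlgebra.coeffAddEquiv : SkewMonoidAlgebra P G ≃+ (G →₀ P)).toAddMonoidHom

instance : Star (Cc α) := ⟨starAddHom α⟩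

theorem star_single (g : G) (a : P) : star (single α g a) = single α g⁻¹ (α g⁻¹ (star a)) :=
  Finsupp.liftAddHom_apply_single _ _ _

theorem star_add' (x y : Cc α) : star (x + y) = star x + star y := map_add (starAddHom α) x y

theorem star_zero' : star (0 : Cc α) = 0 := map_zero (starAddHom α)

instance : StarRing (Cc α) where
  star_involutive x := by
    induction x using induction_on with
    | zero => rw [star_zero', star_zero']
    | add x y hx hy => rw [star_add', star_add', hx, hy]
    | single g a =>
      have : α g⁻¹⁻¹ (star (α g⁻¹ (star a))) = a := by
        rw [← map_star, star_star, ← StarAlgEquiv.mul_apply, ← map_mul]; simp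
      rw [star_single, star_single, this, inv_inv]
  star_mul x y := by
    induction x using induction_on with
    | zero => rw [zero_mul, star_zero', mul_zero]
    | add x x' hx hx' => rw [add_mul, star_add', star_add', mul_add, hx, hx']
    | single g a =>
      induction y using induction_on with
      | zero => rw [mul_zero, star_zero', zero_mul]
      | add y y' hy hy' => rw [mul_add, star_add', star_add', add_mul, hy, hy']
      | single h b =>
        rw [single_mul_single, star_single, star_single, star_single, single_mul_single]
        have : α (g * h)⁻¹ (star (a * α g b)) = α h⁻¹ (star b) * α h⁻¹ (α g⁻¹ (star a)) := by
          rw [star_mul, map_mul, ← map_star (α g), ← StarAlgEquiv.mul_apply, ← map_mul,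
            ← StarAlgEquiv.mul_apply, ← map_mul]
          simp
        rw [this, mul_inv_rev]
  star_add := star_add'

instance : StarModule ℂ (Cc α) where
  star_smul c x := by
    induction x using induction_on with
    | zero => rw [smul_zero, star_zero', smul_zero]
    | add x y hx hy => rw [smul_add, star_add', star_add', hx, hy, smul_add]
    | single g a => rw [smul_single, star_single, star_single, smul_single, star_smul, map_smul]

/-- The `*`-homomorphism on `C_c(G, P)` given by a covariant pair `(π, U)`. -/
def lift {M : Type*} [Ring M] [StarRing M] [Algebra ℂ M] (π : P →⋆ₐ[ℂ] M) (U : G →* M)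
    (hU : ∀ g, star (U g) = U g⁻¹) (hc : ∀ g a, π (α g a) * U g = U g * π a) :
    Cc α →⋆ₐ[ℂ] M :=
  let φ : Cc α →+ M := SkewMonoidAlgebra.liftNC (π : P →+ M) U
  have hφ : ∀ g a, φ (single α g a) = π a * U g := fun g a =>
    SkewMonoidAlgebra.liftNC_single _ _ _ _
  { toFun := φ
    map_one' := by rw [one_def, hφ, map_one, map_one, one_mul]
    map_mul' := fun x y => by
      induction x using induction_on with
      | zero => rw [zero_mul, map_zero, zero_mul]
      | add x x' hx hx' => rw [add_mul, map_add, map_add, add_mul, hx, hx']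
      | single g a =>
        induction y using induction_on with
        | zero => rw [mul_zero, map_zero, mul_zero]
        | add y y' hy hy' => rw [mul_add, map_add, map_add, mul_add, hy, hy']
        | single h b =>
          rw [single_mul_single, hφ, hφ, hφ, map_mul, map_mul, mul_assoc, ← mul_assoc _ (U g), hc]
          simp only [mul_assoc]
    map_zero' := map_zero φ
    map_add' := map_add φ
    commutes' := fun c => by
      rw [Algebra.algebraMap_eq_smul_one, one_def, smul_single, hφ, map_one, mul_one, map_smul,
        map_one, Algebra.algebraMap_eq_smul_one]
    map_star' := fun x => by
      induction x using induction_on with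
      | zero => rw [star_zero', map_zero, star_zero]
      | add x y hx hy => rw [star_add', map_add, map_add, star_add, hx, hy]
      | single g a => rw [star_single, hφ, hφ, hc, star_mul, hU, map_star] }

theorem lift_single {M : Type*} [Ring M] [StarRing M] [Algebra ℂ M] (π : P →⋆ₐ[ℂ] M) (U : G →* M)
    (hU : ∀ g, star (U g) = U g⁻¹) (hc : ∀ g a, π (α g a) * U g = U g * π a) (g : G) (a : P) :
    lift π U hU hc (single α g a) = π a * U g :=
  SkewMonoidAlgebra.liftNC_single _ _ _ _

variable (α)

/-- The canonical map `C_c(K, P) → C_c(G, P)` of a subgroup `K`. -/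
def incl (K : Subgroup G) : Cc (α.comp K.subtype) →⋆ₐ[ℂ] Cc α :=
  lift
    { toFun := single α 1
      map_one' := rfl
      map_mul' := fun a b => by simp [single_mul_single]
      map_zero' := single_zero 1
      map_add' := single_add 1
      commutes' := fun c => by
        rw [Algebra.algebraMap_eq_smul_one, Algebra.algebraMap_eq_smul_one, one_def, smul_single]
      map_star' := fun a => by simp [star_single] }
    { toFun := fun k => single α k 1
      map_one' := rfl
      map_mul' := fun k l => by simp [single_mul_single] }
    (fun k => show star (single α k 1) = single α (k⁻¹ : K) 1 by simp [star_single])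
    (fun k a => show single α 1 (α k a) * single α k 1 = single α k 1 * single α 1 a by
      simp [single_mul_single])

theorem incl_single (K : Subgroup G) (k : K) (a : P) :
    incl α K (single _ k a) = single α k a := by
  refine (lift_single _ _ _ _ _ _).trans ?_
  show single α 1 a * single α k 1 = single α k a
  simp [single_mul_single]

/-- The map `∑ a_g g ↦ ∑ a_h h` of `C_c(G, P)` to `C_c(H, P)`. -/
def restrict (H : Subgroup G) (x : Cc α) : Cc (α.comp H.subtype) :=
  SkewMonoidAlgebra.ofCoeff ((coeff α x).comapDomain (fun h : H => (h : G))
    Subtype.val_injective.injOn)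

end Cc

variable (α : G →* (P ≃⋆ₐ[ℂ] P))

/-! #### The reduced norm -/

section Reduced

variable {V : Type*} [NormedAddCommGroup V] [InnerProductSpace ℂ V] [CompleteSpace V]
  (ρ : P →⋆ₐ[ℂ] (V →L[ℂ] V))

/-- The Hilbert space `V ⊗ ℓ²(G)`, as the space of square-summable functions `G → V`. -/
abbrev L2 (G V : Type*) [NormedAddCommGroup V] := lp (fun _ : G => V) 2

theorem norm_rho_le (g : G) (a : P) : ‖ρ (α g a)‖ ≤ ‖a‖ :=
  (NonUnitalStarAlgHom.norm_apply_le ρ _).trans (NonUnitalStarAlgHom.norm_apply_le (α g) a)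

/-- The representation `π` of `P` on `V ⊗ ℓ²(G)`, `(π(a) ξ)(s) = ρ(α_{s⁻¹}(a)) (ξ(s))`. -/
def regPi : P →⋆ₐ[ℂ] (L2 G V →L[ℂ] L2 G V) where
  toFun a := lp.mapCLM 2 (fun s : G => ρ (α s⁻¹ a)) (norm_nonneg a)
    (fun s => norm_rho_le α ρ s⁻¹ a)
  map_one' := by ext ξ s; simp
  map_mul' a b := by ext ξ s; simp
  map_zero' := by ext ξ s; simp
  map_add' a b := by ext ξ s; simp
  commutes' c := by ext ξ s; simp [Algebra.algebraMap_eq_smul_one]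
  map_star' a := by
    rw [ContinuousLinearMap.star_eq_adjoint, ContinuousLinearMap.eq_adjoint_iff]
    intro ξ η
    rw [lp.inner_eq_tsum, lp.inner_eq_tsum]
    refine tsum_congr fun s => ?_
    simp only [lp.mapCLM_apply_coe, map_star]
    rw [ContinuousLinearMap.star_eq_adjoint, ContinuousLinearMap.adjoint_inner_left]

theorem memℓp_translate {V : Type*} [NormedAddCommGroup V] (ξ : L2 G V) (g : G) : Memℓp (fun s => ξ (g⁻¹ * s)) 2 := by
  refine memℓp_gen ?_
  exact (Equiv.mulLeft g⁻¹).summable_iff.mpr ((lp.memℓp ξ).summable (by simp))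

/-- The operator `1 ⊗ λ_g` on `V ⊗ ℓ²(G)`, `(λ_g ξ)(s) = ξ(g⁻¹ s)`. -/
def regLam : G →* (L2 G V →L[ℂ] L2 G V) where
  toFun g := LinearMap.mkContinuous
    { toFun := fun ξ => ⟨fun s => ξ (g⁻¹ * s), memℓp_translate ξ g⟩
      map_add' := fun ξ η => by ext s; rfl
      map_smul' := fun c ξ => by ext s; simp } 1
    (fun ξ => by
      rw [one_mul]
      refine lp.norm_le_of_tsum_le (by simp) (norm_nonneg ξ) ?_
      rw [lp.norm_rpow_eq_tsum (by simp)]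
      exact ((Equiv.mulLeft g⁻¹).tsum_eq (fun s => ‖ξ s‖ ^ (2 : ENNReal).toReal)).le)
  map_one' := by ext ξ s; simp
  map_mul' g h := by ext ξ s; simp [mul_assoc]

theorem regLam_apply {V : Type*} [NormedAddCommGroup V] [InnerProductSpace ℂ V] (g : G) (ξ : L2 G V) (s : G) : regLam g ξ s = ξ (g⁻¹ * s) := rfl

/-- The regular representation of `C_c(G, P)` on `V ⊗ ℓ²(G)`, `∑ a_g g ↦ ∑ π(a_g) (1 ⊗ λ_g)`. -/
def regRep : Cc α →⋆ₐ[ℂ] (L2 G V →L[ℂ] L2 G V) :=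
  Cc.lift (regPi α ρ) regLam
    (fun g => by
      symm
      rw [ContinuousLinearMap.star_eq_adjoint, ContinuousLinearMap.eq_adjoint_iff]
      intro ξ η
      rw [lp.inner_eq_tsum, lp.inner_eq_tsum, ← (Equiv.mulLeft g⁻¹).tsum_eq]
      simp [regLam_apply])
    (fun g a => by
      ext ξ s
      simp [regPi, regLam_apply])

/-- The reduced norm `‖∑ a_g g‖_r` on `C_c(G, P)`, for a representation `ρ` of `P` on `V`. -/
def reducedNorm : CStarSeminorm (Cc α) := CStarSeminorm.ofRep (regRep α ρ)

end Reduced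

/-! #### The universal norm -/

/-- The norms `‖π x‖` for all `*`-representations `π` of `C_c(G, P)` on Hilbert spaces. -/
def repNorms (x : Cc α) : Set ℝ :=
  {r | ∃ (V : Type (max u v)) (_ : NormedAddCommGroup V) (_ : InnerProductSpace ℂ V)
    (_ : CompleteSpace V) (π : Cc α →⋆ₐ[ℂ] (V →L[ℂ] V)), r = ‖π x‖}

variable {α}

theorem bddAbove_repNorms (x : Cc α) : BddAbove (repNorms α x) := by
  induction x using Cc.induction_on with
  | zero =>
    refine ⟨0, ?_⟩
    rintro _ ⟨V, _, _, _, π, rfl⟩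
    simp
  | add x y hx hy =>
    obtain ⟨c, hc⟩ := hx
    obtain ⟨d, hd⟩ := hy
    refine ⟨c + d, ?_⟩
    rintro _ ⟨V, _, _, _, π, rfl⟩
    rw [map_add]
    exact (norm_add_le _ _).trans
      (add_le_add (hc ⟨V, _, _, _, π, rfl⟩) (hd ⟨V, _, _, _, π, rfl⟩))
  | single g a =>
    refine ⟨‖a‖, ?_⟩
    rintro _ ⟨V, _, _, _, π, rfl⟩
    let π₁ : P →⋆ₐ[ℂ] (V →L[ℂ] V) := π.comp
      { toFun := Cc.single α 1
        map_one' := rfl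
        map_mul' := fun a b => by simp [Cc.single_mul_single]
        map_zero' := Cc.single_zero 1
        map_add' := Cc.single_add 1
        commutes' := fun c => by
          rw [Algebra.algebraMap_eq_smul_one, Algebra.algebraMap_eq_smul_one, Cc.one_def,
            Cc.smul_single]
        map_star' := fun a => by simp [Cc.star_single] }
    have h1 : star (Cc.single α g a) * Cc.single α g a = Cc.single α 1 (α g⁻¹ (star a * a)) := by
      simp [Cc.star_single, Cc.single_mul_single]
    have h2 : ‖π (Cc.single α g a)‖ * ‖π (Cc.single α g a)‖ ≤ ‖a‖ * ‖a‖ := by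
      rw [← CStarRing.norm_star_mul_self, ← map_star, ← map_mul, h1,
        ← CStarRing.norm_star_mul_self (x := a)]
      exact norm_rho_le α π₁ g⁻¹ (star a * a)
    exact (mul_self_le_mul_self_iff (norm_nonneg _) (norm_nonneg _)).mpr h2

theorem le_sSup_repNorms {V : Type (max u v)} [NormedAddCommGroup V] [InnerProductSpace ℂ V]
    [CompleteSpace V] (π : Cc α →⋆ₐ[ℂ] (V →L[ℂ] V)) (x : Cc α) : ‖π x‖ ≤ sSup (repNorms α x) :=
  le_csSup (bddAbove_repNorms x) ⟨V, _, _, _, π, rfl⟩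

theorem sSup_repNorms_nonneg (x : Cc α) : 0 ≤ sSup (repNorms α x) := by
  refine Real.sSup_nonneg ?_
  rintro _ ⟨V, _, _, _, π, rfl⟩
  exact norm_nonneg _

theorem sSup_repNorms_le {x : Cc α} {c : ℝ} (hc : 0 ≤ c)
    (h : ∀ (V : Type (max u v)) [NormedAddCommGroup V] [InnerProductSpace ℂ V] [CompleteSpace V]
      (π : Cc α →⋆ₐ[ℂ] (V →L[ℂ] V)), ‖π x‖ ≤ c) : sSup (repNorms α x) ≤ c := by
  refine Real.sSup_le ?_ hc
  rintro _ ⟨V, _, _, _, π, rfl⟩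
  exact h V π

variable (α)

/-- The universal norm `‖x‖_u = sup_π ‖π x‖` on `C_c(G, P)`, over all `*`-representations `π` on
Hilbert spaces. (All cyclic representations occur, up to unitary equivalence, on Hilbert spaces in
the universe of `C_c(G, P)`.) -/
def universalNorm : CStarSeminorm (Cc α) where
  toSeminorm := Seminorm.ofSMulLE (𝕜 := ℂ) (E := Cc α) (fun x => sSup (repNorms α x))
    (le_antisymm (sSup_repNorms_le le_rfl fun V _ _ _ π => by simp) (sSup_repNorms_nonneg _))
    (fun x y => sSup_repNorms_le (add_nonneg (sSup_repNorms_nonneg x) (sSup_repNorms_nonneg y))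
      fun V _ _ _ π => by
        rw [map_add]
        exact (norm_add_le _ _).trans (add_le_add (le_sSup_repNorms π x) (le_sSup_repNorms π y)))
    (fun c x => sSup_repNorms_le (mul_nonneg (norm_nonneg c) (sSup_repNorms_nonneg x))
      fun V _ _ _ π => by
        rw [map_smul, norm_smul]
        exact mul_le_mul_of_nonneg_left (le_sSup_repNorms π x) (norm_nonneg c))
  mul_le' x y := sSup_repNorms_le (mul_nonneg (sSup_repNorms_nonneg x) (sSup_repNorms_nonneg y))
    fun V _ _ _ π => by
      rw [map_mul]
      exact (norm_mul_le _ _).trans (mul_le_mul (le_sSup_repNorms π x) (le_sSup_repNorms π y)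
        (norm_nonneg _) (sSup_repNorms_nonneg x))
  star_mul_self' x := by
    have hn := sSup_repNorms_nonneg x
    have hn' := sSup_repNorms_nonneg (star x * x)
    have h : ∀ (V : Type (max u v)) [NormedAddCommGroup V] [InnerProductSpace ℂ V]
        [CompleteSpace V] (π : Cc α →⋆ₐ[ℂ] (V →L[ℂ] V)), ‖π (star x * x)‖ = ‖π x‖ * ‖π x‖ :=
      fun V _ _ _ π => by rw [map_mul, map_star]; exact CStarRing.norm_star_mul_self
    refine le_antisymm (sSup_repNorms_le (mul_nonneg hn hn) fun V _ _ _ π => ?_) ?_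
    · rw [h]
      exact mul_self_le_mul_self (norm_nonneg _) (le_sSup_repNorms π x)
    · show sSup (repNorms α x) * sSup (repNorms α x) ≤ sSup (repNorms α (star x * x))
      rw [← pow_two, ← Real.le_sqrt hn hn']
      refine sSup_repNorms_le (Real.sqrt_nonneg _) fun V _ _ _ π => Real.le_sqrt_of_sq_le ?_
      rw [pow_two, ← h]
      exact le_sSup_repNorms π _

/-! #### Crossed products and their subalgebras

For `p` the reduced (universal) norm, `p.Compl` is the reduced (universal) crossed product of `P`
by `G`. -/

variable {α} (p : CStarSeminorm (Cc α))

/-- The crossed product of `P` by a subgroup `K` as a subalgebra of the crossed product by `G`: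
the closure of the image of `C_c(K, P)`. -/
def subCrossed (K : Subgroup G) : StarSubalgebra ℂ p.Compl :=
  (StarAlgHom.range (A := Cc (α.comp K.subtype)) (B := p.Compl)
    (p.toCompl.comp (Cc.incl α K))).topologicalClosure

/-- `E` extends the map `C_c(G, P) → C_c(H, P)`, `∑ a_g g ↦ ∑ a_h h`. -/
def IsCanonicalExp (H : Subgroup G) (E : CondExp (subCrossed p H)) : Prop :=
  ∀ x : Cc α, E.toMap (p.toCompl x) = p.toCompl (Cc.incl α H (Cc.restrict α H x))

end Crossed

end WatataniAngle

end

noncomputable section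

namespace WatataniAngle

/-! ### Positivity of unital contractions and existence of representations -/

section CStar

variable {A : Type*} [CStarAlgebra A]

theorem norm_algebraMap_sub_star_mul_self_le (a : A) :
    ‖algebraMap ℝ A ‖star a * a‖ - star a * a‖ ≤ ‖star a * a‖ := by
  let _ := CStarAlgebra.spectralOrder A
  have := CStarAlgebra.spectralOrderedRing A
  have hs : IsSelfAdjoint (star a * a) := .star_mul_self a
  have h : SpectrumRestricts (star a * a) ContinuousMap.realToNNReal :=
    (nonneg_iff_isSelfAdjoint_and_quasispectrumRestricts.mp (star_mul_self_nonneg a)).2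
  exact (SpectrumRestricts.nnreal_iff_nnnorm (t := ‖star a * a‖₊) hs le_rfl).mp h

theorem exists_eq_star_mul_self_of_norm_sub_le {b : A} (hb : IsSelfAdjoint b) {t : ℝ}
    (hbt : ‖b‖ ≤ t) (h : ‖algebraMap ℝ A t - b‖ ≤ t) : ∃ c, b = star c * c := by
  let _ := CStarAlgebra.spectralOrder A
  have := CStarAlgebra.spectralOrderedRing A
  lift t to NNReal using (norm_nonneg b).trans hbt
  refine CStarAlgebra.nonneg_iff_eq_star_mul_self.mp ?_
  exact nonneg_iff_isSelfAdjoint_and_quasispectrumRestricts.mpr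
    ⟨hb, (SpectrumRestricts.nnreal_iff_nnnorm hb hbt).mpr h⟩

/-- A unital contraction that preserves the involution is positive. -/
theorem exists_map_star_mul_self (φ : A →ₗ[ℂ] A) (h1 : φ 1 = 1)
    (hstar : ∀ a, φ (star a) = star (φ a)) (hφ : ∀ a, ‖φ a‖ ≤ ‖a‖) (a : A) :
    ∃ c, φ (star a * a) = star c * c := by
  refine exists_eq_star_mul_self_of_norm_sub_le (t := ‖star a * a‖) ?_ (hφ _) ?_
  · rw [IsSelfAdjoint, ← hstar, star_mul, star_star]
  · have h : algebraMap ℝ A ‖star a * a‖ - φ (star a * a)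
        = φ (algebraMap ℝ A ‖star a * a‖ - star a * a) := by
      rw [map_sub, Algebra.algebraMap_eq_smul_one, ← Complex.coe_smul, map_smul, h1]
    rw [h]
    exact (hφ _).trans (norm_algebraMap_sub_star_mul_self_le a)

open scoped ComplexOrder in
/-- A nonzero unital `C*`-algebra has a nonzero representation on a Hilbert space. -/
theorem exists_nontrivial_rep (P : Type u) [CStarAlgebra P] [Nontrivial P] :
    ∃ (V : Type u) (_ : NormedAddCommGroup V) (_ : InnerProductSpace ℂ V) (_ : CompleteSpace V)
      (_ : P →⋆ₐ[ℂ] (V →L[ℂ] V)), Nontrivial V := by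
  let _ := CStarAlgebra.spectralOrder P
  have := CStarAlgebra.spectralOrderedRing P
  obtain ⟨g, hg, hg1⟩ := exists_dual_vector ℂ (1 : P) (by simp)
  have hg1 : g 1 = 1 := by simpa using hg1
  have hle : ∀ a, ‖g a‖ ≤ ‖a‖ := fun a => by simpa [hg] using g.le_opNorm a
  let f₀ : P →ₗ[ℂ] ℂ :=
    { toFun := fun a => g a + star (g (star a))
      map_add' := fun a b => by simp; ring
      map_smul' := fun c a => by simp [mul_add] }
  have hf₀ : ∀ a, 0 ≤ a → 0 ≤ f₀ a := fun a ha => by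
    obtain ⟨b, rfl⟩ := CStarAlgebra.nonneg_iff_eq_star_mul_self.mp ha
    have h := (hle _).trans (norm_algebraMap_sub_star_mul_self_le b)
    rw [map_sub, Algebra.algebraMap_eq_smul_one, ← Complex.coe_smul, map_smul, hg1] at h
    have h2 := (abs_le.mp ((Complex.abs_re_le_norm _).trans h)).2
    have h3 : 0 ≤ (g (star b * b)).re := by simpa using h2
    have h4 : f₀ (star b * b) = ((2 * (g (star b * b)).re : ℝ) : ℂ) := by
      show g (star b * b) + star (g (star (star b * b))) = _
      rw [star_mul, star_star, Complex.star_def, Complex.add_conj]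
    rw [h4]
    exact_mod_cast mul_nonneg two_pos.le h3
  let f : P →ₚ[ℂ] ℂ := PositiveLinearMap.mk₀ f₀ hf₀
  refine ⟨f.GNS, inferInstance, inferInstance, inferInstance, f.gnsStarAlgHom, ?_⟩
  refine ⟨⟨((f.toPreGNS 1 : f.PreGNS) : f.GNS), 0, fun h => ?_⟩⟩
  have h1 : ‖f.toPreGNS 1‖ = 0 := by
    rw [← UniformSpace.Completion.norm_coe, h, norm_zero]
  have h2 := f.preGNS_norm_sq (f.toPreGNS 1)
  have h3 : f 1 = 2 := by
    show g 1 + star (g (star 1)) = 2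
    rw [star_one, hg1, star_one]; norm_num
  rw [h1] at h2
  simp [h3] at h2

end CStar

end WatataniAngle

end

noncomputable section

namespace WatataniAngle

section Crossed

variable {P : Type u} [CStarAlgebra P] {G : Type v} [Group G] {α : G →* (P ≃⋆ₐ[ℂ] P)}

/-! ### The projections of `C_c(G, P)` onto `C_c(M, P)` -/

namespace Cc

theorem restrict_add (M : Subgroup G) (x y : Cc α) :
    restrict α M (x + y) = restrict α M x + restrict α M y := by
  apply SkewMonoidAlgebra.coeff_injective
  ext m
  refine (DFunLike.congr_fun (SkewMonoidAlgebra.coeff_add (k := P) (G := G) x y) (m : G)).trans ?_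
  exact (DFunLike.congr_fun (SkewMonoidAlgebra.coeff_add (k := P) (G := M)
    (restrict α M x) (restrict α M y)) m).symm

theorem restrict_smul (M : Subgroup G) (c : ℂ) (x : Cc α) :
    restrict α M (c • x) = c • restrict α M x := by
  apply SkewMonoidAlgebra.coeff_injective
  ext m
  rfl

theorem restrict_single_of_mem {M : Subgroup G} {g : G} (hg : g ∈ M) (a : P) :
    restrict α M (single α g a) = single (α.comp M.subtype) ⟨g, hg⟩ a := by
  classical
  apply SkewMonoidAlgebra.coeff_injective
  ext m
  show Finsupp.single g a (m : G) = Finsupp.single (⟨g, hg⟩ : M) a m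
  rw [Finsupp.single_apply, Finsupp.single_apply]
  exact if_congr (by rw [Subtype.ext_iff]) rfl rfl

theorem restrict_single_of_notMem {M : Subgroup G} {g : G} (hg : g ∉ M) (a : P) :
    restrict α M (single α g a) = 0 := by
  classical
  apply SkewMonoidAlgebra.coeff_injective
  ext m
  show Finsupp.single g a (m : G) = 0
  exact Finsupp.single_eq_of_ne fun h => hg (h ▸ m.2)

variable (α) in
/-- The map `∑ a_g g ↦ ∑ a_m m` of `C_c(G, P)` onto the image of `C_c(M, P)`. -/
def retract (M : Subgroup G) : Cc α →ₗ[ℂ] Cc α where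
  toFun x := incl α M (restrict α M x)
  map_add' x y := by rw [restrict_add, map_add]
  map_smul' c x := by rw [restrict_smul, map_smul, RingHom.id_apply]

theorem retract_single_of_mem {M : Subgroup G} {g : G} (hg : g ∈ M) (a : P) :
    retract α M (single α g a) = single α g a := by
  show incl α M (restrict α M _) = _
  rw [restrict_single_of_mem hg, incl_single]

theorem retract_single_of_notMem {M : Subgroup G} {g : G} (hg : g ∉ M) (a : P) :
    retract α M (single α g a) = 0 := by
  show incl α M (restrict α M _) = _
  rw [restrict_single_of_notMem hg, map_zero]

theorem retract_one (M : Subgroup G) : retract α M 1 = 1 :=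
  retract_single_of_mem M.one_mem 1

theorem retract_retract {M N : Subgroup G} (h : M ≤ N) (x : Cc α) :
    retract α M (retract α N x) = retract α M x := by
  induction x using induction_on with
  | zero => simp only [map_zero]
  | add x y hx hy => simp only [map_add, hx, hy]
  | single g a =>
    by_cases hg : g ∈ N
    · rw [retract_single_of_mem hg]
    · rw [retract_single_of_notMem hg, map_zero, retract_single_of_notMem fun hm => hg (h hm)]

theorem retract_star (M : Subgroup G) (x : Cc α) :
    retract α M (star x) = star (retract α M x) := by
  induction x using induction_on with
  | zero => simp only [star_zero, map_zero]
  | add x y hx hy => simp only [star_add, map_add, hx, hy]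
  | single g a =>
    by_cases hg : g ∈ M
    · rw [retract_single_of_mem hg, star_single, retract_single_of_mem (M.inv_mem hg)]
    · rw [retract_single_of_notMem hg, star_single, star_zero,
        retract_single_of_notMem (mt M.inv_mem_iff.mp hg)]

theorem retract_incl_mul (M : Subgroup G) (y : Cc (α.comp M.subtype)) (x : Cc α) :
    retract α M (incl α M y * x) = incl α M y * retract α M x := by
  induction y using induction_on with
  | zero => simp only [map_zero, zero_mul]
  | add y z hy hz => simp only [map_add, add_mul, hy, hz]
  | single m b =>
    induction x using induction_on with
    | zero => simp only [map_zero, mul_zero]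
    | add y z hy hz => simp only [map_add, mul_add, hy, hz]
    | single g a =>
      rw [incl_single, single_mul_single]
      by_cases hg : g ∈ M
      · rw [retract_single_of_mem hg, retract_single_of_mem (M.mul_mem m.2 hg), single_mul_single]
      · rw [retract_single_of_notMem hg, mul_zero,
          retract_single_of_notMem (mt (M.mul_mem_cancel_left m.2).mp hg)]

end Cc

/-! ### The canonical conditional expectations -/

variable (p : CStarSeminorm (Cc α)) {M : Subgroup G}

/-- The extension of `∑ a_g g ↦ ∑ a_m m` to the crossed product, if it is contractive. -/
def canonicalMap (hM : ∀ x, p.toSeminorm (Cc.retract α M x) ≤ p.toSeminorm x) :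
    p.Compl →L[ℂ] p.Compl :=
  ((show p.Carrier →ₗ[ℂ] p.Carrier from Cc.retract α M).mkContinuous 1
    (fun x => by rw [one_mul]; exact hM x)).completion

variable {p}

theorem canonicalMap_toCompl (hM : ∀ x, p.toSeminorm (Cc.retract α M x) ≤ p.toSeminorm x)
    (x : Cc α) : canonicalMap p hM (p.toCompl x) = p.toCompl (Cc.retract α M x) :=
  ContinuousLinearMap.completion_apply_coe _ _

/-- Continuous maps on the crossed product that agree on `C_c(G, P)` are equal. -/
theorem eq_of_eq_on_toCompl {X : Type*} [TopologicalSpace X] [T2Space X] {f g : p.Compl → X}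
    (hf : Continuous f) (hg : Continuous g) (h : ∀ x, f (p.toCompl x) = g (p.toCompl x))
    (a : p.Compl) : f a = g a :=
  congrFun (p.denseRange_toCompl.equalizer hf hg (funext h)) a

theorem toCompl_incl_mem (M : Subgroup G) (y : Cc (α.comp M.subtype)) :
    p.toCompl (Cc.incl α M y) ∈ subCrossed p M :=
  StarSubalgebra.le_topologicalClosure _ ⟨y, rfl⟩

theorem isClosed_subCrossed (M : Subgroup G) : IsClosed (subCrossed p M : Set p.Compl) :=
  StarSubalgebra.isClosed_topologicalClosure _

theorem subCrossed_induction {q : p.Compl → Prop} (hq : IsClosed {a | q a})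
    (h : ∀ y, q (p.toCompl (Cc.incl α M y))) {a : p.Compl} (ha : a ∈ subCrossed p M) : q a := by
  refine closure_minimal (s := Set.range fun y => p.toCompl (Cc.incl α M y)) ?_ hq ?_
  · rintro _ ⟨y, rfl⟩
    exact h y
  · exact ha

theorem toCompl_single_mem {g : G} (hg : g ∈ M) (a : P) :
    p.toCompl (Cc.single α g a) ∈ subCrossed p M := by
  have := toCompl_incl_mem (p := p) M (Cc.single _ ⟨g, hg⟩ a)
  rwa [Cc.incl_single] at this

theorem subCrossed_mono {M N : Subgroup G} (h : M ≤ N) : subCrossed p M ≤ subCrossed p N := by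
  intro a ha
  refine subCrossed_induction (q := (· ∈ subCrossed p N)) (isClosed_subCrossed N) (fun y => ?_) ha
  induction y using Cc.induction_on with
  | zero => rw [map_zero, map_zero]; exact zero_mem _
  | add x y hx hy => rw [map_add, map_add]; exact add_mem hx hy
  | single m a => rw [Cc.incl_single]; exact toCompl_single_mem (h m.2) a

theorem norm_canonicalMap_le (hM : ∀ x, p.toSeminorm (Cc.retract α M x) ≤ p.toSeminorm x)
    (a : p.Compl) : ‖canonicalMap p hM a‖ ≤ ‖a‖ := by
  refine p.denseRange_toCompl.induction_on a
    (isClosed_le (canonicalMap p hM).continuous.norm continuous_norm) fun x => ?_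
  rw [canonicalMap_toCompl, p.norm_toCompl, p.norm_toCompl]
  exact hM x

theorem canonicalMap_star (hM : ∀ x, p.toSeminorm (Cc.retract α M x) ≤ p.toSeminorm x)
    (a : p.Compl) : canonicalMap p hM (star a) = star (canonicalMap p hM a) := by
  have hs := p.continuous_star_compl
  have hc := (canonicalMap p hM).continuous
  refine eq_of_eq_on_toCompl (hc.comp hs) (hs.comp hc) (fun x => ?_) a
  simp only [Function.comp_apply]
  rw [← map_star, canonicalMap_toCompl, Cc.retract_star, map_star, canonicalMap_toCompl]

theorem canonicalMap_mul_left (hM : ∀ x, p.toSeminorm (Cc.retract α M x) ≤ p.toSeminorm x)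
    {b : p.Compl} (hb : b ∈ subCrossed p M) (a : p.Compl) :
    canonicalMap p hM (b * a) = b * canonicalMap p hM a := by
  have hc := (canonicalMap p hM).continuous
  refine eq_of_eq_on_toCompl (f := fun a => canonicalMap p hM (b * a))
    (g := fun a => b * canonicalMap p hM a) (by fun_prop) (by fun_prop) (fun x => ?_) a
  refine subCrossed_induction (q := fun b => canonicalMap p hM (b * p.toCompl x)
    = b * canonicalMap p hM (p.toCompl x)) (isClosed_eq (by fun_prop) (by fun_prop))
    (fun y => ?_) hb
  rw [← map_mul, canonicalMap_toCompl, canonicalMap_toCompl, ← map_mul, Cc.retract_incl_mul]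

theorem canonicalMap_mul_right (hM : ∀ x, p.toSeminorm (Cc.retract α M x) ≤ p.toSeminorm x)
    {b : p.Compl} (hb : b ∈ subCrossed p M) (a : p.Compl) :
    canonicalMap p hM (a * b) = canonicalMap p hM a * b := by
  apply star_injective
  rw [← canonicalMap_star, star_mul, star_mul, canonicalMap_mul_left hM (star_mem hb),
    canonicalMap_star]

/-- The canonical conditional expectation onto the crossed product by a subgroup. -/
def canonicalExp (hM : ∀ x, p.toSeminorm (Cc.retract α M x) ≤ p.toSeminorm x) :
    CondExp (subCrossed p M) where
  toMap := canonicalMap p hM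
  map_mem a := by
    refine p.denseRange_toCompl.induction_on a
      ((isClosed_subCrossed M).preimage (canonicalMap p hM).continuous) fun x => ?_
    rw [ContinuousLinearMap.coe_coe, canonicalMap_toCompl]
    exact toCompl_incl_mem M _
  map_of_mem b hb := by
    have h1 : canonicalMap p hM 1 = 1 := by
      rw [← map_one p.toCompl, canonicalMap_toCompl, Cc.retract_one]
    have := canonicalMap_mul_left hM hb 1
    rwa [h1, mul_one] at this
  map_mul_mul b hb c hc a := by
    simp only [ContinuousLinearMap.coe_coe]
    rw [canonicalMap_mul_right hM hc, canonicalMap_mul_left hM hb]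
  map_star_mul_self := by
    refine exists_map_star_mul_self _ ?_ (canonicalMap_star hM) (norm_canonicalMap_le hM)
    rw [ContinuousLinearMap.coe_coe, ← map_one p.toCompl, canonicalMap_toCompl, Cc.retract_one]
  norm_map_le := norm_canonicalMap_le hM

theorem isCanonicalExp_canonicalExp
    (hM : ∀ x, p.toSeminorm (Cc.retract α M x) ≤ p.toSeminorm x) :
    IsCanonicalExp p M (canonicalExp hM) :=
  canonicalMap_toCompl hM

end Crossed

end WatataniAngle

end

noncomputable section

namespace WatataniAngle

section Crossed

variable {P : Type u} [CStarAlgebra P] {G : Type v} [Group G] {α : G →* (P ≃⋆ₐ[ℂ] P)}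

/-! ### The projections are contractive for the universal norm -/

section Induced

variable {V : Type*} [NormedAddCommGroup V] [InnerProductSpace ℂ V] [CompleteSpace V]

/-- The diagonal action of the operators on `V` on `ℓ²(X, V)`. -/
def diagRep (X V : Type*) [NormedAddCommGroup V] [InnerProductSpace ℂ V] [CompleteSpace V] :
    (V →L[ℂ] V) →⋆ₐ[ℂ] (L2 X V →L[ℂ] L2 X V) where
  toFun T := lp.mapCLM 2 (fun _ : X => T) (norm_nonneg T) (fun _ => le_rfl)
  map_one' := by ext ξ s; simp
  map_mul' a b := by ext ξ s; simp
  map_zero' := by ext ξ s; simp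
  map_add' a b := by ext ξ s; simp
  commutes' c := by ext ξ s; simp [Algebra.algebraMap_eq_smul_one]
  map_star' a := by
    refine (ContinuousLinearMap.eq_adjoint_iff _ _).mpr fun ξ η => ?_
    rw [lp.inner_eq_tsum, lp.inner_eq_tsum]
    refine tsum_congr fun s => ?_
    simp only [lp.mapCLM_apply_coe]
    rw [ContinuousLinearMap.star_eq_adjoint, ContinuousLinearMap.adjoint_inner_left]

theorem memℓp_smul {X V : Type*} [MulAction G X] [NormedAddCommGroup V] (ξ : L2 X V) (g : G) :
    Memℓp (fun s => ξ (g⁻¹ • s)) 2 := by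
  refine memℓp_gen ?_
  exact ((MulAction.toPerm g⁻¹ : Equiv.Perm X).summable_iff
    (f := fun s => ‖ξ s‖ ^ (2 : ENNReal).toReal)).mpr ((lp.memℓp ξ).summable (by simp))

/-- The permutation representation of `G` on `ℓ²(X, V)`. -/
def permRep (G X V : Type*) [Group G] [MulAction G X] [NormedAddCommGroup V]
    [InnerProductSpace ℂ V] : G →* (L2 X V →L[ℂ] L2 X V) where
  toFun g := LinearMap.mkContinuous
    { toFun := fun ξ => ⟨fun s => ξ (g⁻¹ • s), memℓp_smul ξ g⟩
      map_add' := fun ξ η => by ext s; rfl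
      map_smul' := fun c ξ => by ext s; simp } 1
    (fun ξ => by
      rw [one_mul]
      refine lp.norm_le_of_tsum_le (by simp) (norm_nonneg ξ) ?_
      rw [lp.norm_rpow_eq_tsum (by simp)]
      exact ((MulAction.toPerm g⁻¹).tsum_eq (fun s : X => ‖ξ s‖ ^ (2 : ENNReal).toReal)).le)
  map_one' := by ext ξ s; simp
  map_mul' g h := by ext ξ s; simp [mul_smul]

theorem permRep_apply {X V : Type*} [MulAction G X] [NormedAddCommGroup V]
    [InnerProductSpace ℂ V] (g : G) (ξ : L2 X V) (s : X) :
    permRep G X V g ξ s = ξ (g⁻¹ • s) := rfl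

theorem star_permRep {X : Type*} [MulAction G X] (g : G) :
    star (permRep G X V g) = permRep G X V g⁻¹ := by
  symm
  rw [ContinuousLinearMap.star_eq_adjoint, ContinuousLinearMap.eq_adjoint_iff]
  intro ξ η
  rw [lp.inner_eq_tsum, lp.inner_eq_tsum, ← (MulAction.toPerm g⁻¹).tsum_eq]
  simp [permRep_apply]

theorem diagRep_mul_permRep {X : Type*} [MulAction G X] (T : V →L[ℂ] V) (g : G) :
    diagRep X V T * permRep G X V g = permRep G X V g * diagRep X V T := rfl

variable (α) in
/-- The embedding of `P` into `C_c(G, P)`. -/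
def Cc.singleOne : P →⋆ₐ[ℂ] Cc α where
  toFun := Cc.single α 1
  map_one' := rfl
  map_mul' a b := by simp [Cc.single_mul_single]
  map_zero' := Cc.single_zero 1
  map_add' := Cc.single_add 1
  commutes' c := by
    rw [Algebra.algebraMap_eq_smul_one, Algebra.algebraMap_eq_smul_one, Cc.one_def, Cc.smul_single]
  map_star' a := by simp [Cc.star_single]

variable (α) in
/-- The canonical unitaries of `C_c(G, P)`. -/
def Cc.unitary : G →* Cc α where
  toFun g := Cc.single α g 1
  map_one' := rfl
  map_mul' g h := by simp [Cc.single_mul_single]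

theorem Cc.unitary_apply (g : G) : Cc.unitary α g = Cc.single α g 1 := rfl

theorem Cc.star_unitary (g : G) : star (Cc.unitary α g) = Cc.unitary α g⁻¹ := by
  rw [Cc.unitary_apply, Cc.star_single, star_one, map_one, Cc.unitary_apply]

theorem Cc.singleOne_mul_unitary (g : G) (a : P) :
    Cc.singleOne α a * Cc.unitary α g = Cc.single α g a := by
  show Cc.single α 1 a * Cc.single α g 1 = _
  simp [Cc.single_mul_single]

theorem Cc.singleOne_map_mul_unitary (g : G) (a : P) :
    Cc.singleOne α (α g a) * Cc.unitary α g = Cc.unitary α g * Cc.singleOne α a := by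
  rw [Cc.singleOne_mul_unitary]
  show _ = Cc.single α g 1 * Cc.single α 1 a
  simp [Cc.single_mul_single]

/-- A homomorphism on `C_c(G, P)`, twisted by a unitary representation of `G` in the commutant of
its range. -/
def Cc.twist {N : Type*} [Ring N] [StarRing N] [Algebra ℂ N] (φ : Cc α →⋆ₐ[ℂ] N) (U : G →* N)
    (hU : ∀ g, star (U g) = U g⁻¹) (hc : ∀ x g, φ x * U g = U g * φ x) : Cc α →⋆ₐ[ℂ] N :=
  Cc.lift (φ.comp (Cc.singleOne α))
    { toFun := fun g => φ (Cc.unitary α g) * U g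
      map_one' := by simp
      map_mul' := fun g h => by
        rw [map_mul, map_mul, map_mul, mul_assoc, mul_assoc, ← mul_assoc (U g), ← hc, mul_assoc] }
    (fun g => by
      show star (φ _ * U g) = φ _ * U g⁻¹
      rw [star_mul, hU, ← map_star, Cc.star_unitary, hc])
    (fun g a => by
      show φ (Cc.singleOne α (α g a)) * (φ _ * U g) = φ _ * U g * φ (Cc.singleOne α a)
      rw [mul_assoc, ← hc, ← mul_assoc, ← mul_assoc, ← map_mul, ← map_mul,
        Cc.singleOne_map_mul_unitary])

theorem Cc.twist_single {N : Type*} [Ring N] [StarRing N] [Algebra ℂ N] (φ : Cc α →⋆ₐ[ℂ] N)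
    (U : G →* N) (hU : ∀ g, star (U g) = U g⁻¹) (hc : ∀ x g, φ x * U g = U g * φ x) (g : G)
    (a : P) : Cc.twist φ U hU hc (Cc.single α g a) = φ (Cc.single α g a) * U g := by
  rw [← Cc.singleOne_mul_unitary, map_mul φ, mul_assoc, Cc.singleOne_mul_unitary]
  exact Cc.lift_single _ _ _ _ g a

/-- The tensor product of a representation of `C_c(G, P)` with the permutation representation of
`G` on `ℓ²(X)`. -/
def tensorPermRep (π : Cc α →⋆ₐ[ℂ] (V →L[ℂ] V)) (X : Type*) [MulAction G X] :
    Cc α →⋆ₐ[ℂ] (L2 X V →L[ℂ] L2 X V) :=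
  Cc.twist ((diagRep X V).comp π) (permRep G X V) star_permRep
    fun x g => diagRep_mul_permRep (π x) g

theorem tensorPermRep_single (π : Cc α →⋆ₐ[ℂ] (V →L[ℂ] V)) {X : Type*} [MulAction G X] (g : G)
    (a : P) (ξ : L2 X V) (s : X) :
    tensorPermRep π X (Cc.single α g a) ξ s = π (Cc.single α g a) (ξ (g⁻¹ • s)) :=
  congrArg (fun T : L2 X V →L[ℂ] L2 X V => T ξ s) (Cc.twist_single _ _ _ _ g a)

open Classical in
/-- `π(∑ a_m m)` is the compression of `(π ⊗ λ_{G/M})(∑ a_g g)` to `V ⊗ δ_M`. -/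
theorem apply_retract_eq_tensorPermRep (π : Cc α →⋆ₐ[ℂ] (V →L[ℂ] V)) (M : Subgroup G) (x : Cc α)
    (v : V) : π (Cc.retract α M x) v = tensorPermRep π (G ⧸ M) x
      (lp.single 2 ((1 : G) : G ⧸ M) v) ((1 : G) : G ⧸ M) := by
  induction x using Cc.induction_on with
  | zero => simp
  | add x y hx hy => simp [hx, hy]
  | single g a =>
    rw [tensorPermRep_single, lp.coeFn_single]
    have hg : g⁻¹ • ((1 : G) : G ⧸ M) = ((1 : G) : G ⧸ M) ↔ g ∈ M := by
      rw [MulAction.Quotient.smul_coe, eq_comm, QuotientGroup.eq]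
      simp
    by_cases h : g ∈ M
    · rw [hg.mpr h, Pi.single_eq_same, Cc.retract_single_of_mem h]
    · rw [Pi.single_eq_of_ne (mt hg.mp h), Cc.retract_single_of_notMem h]
      simp

theorem norm_apply_retract_le (π : Cc α →⋆ₐ[ℂ] (V →L[ℂ] V)) (M : Subgroup G) (x : Cc α) :
    ‖π (Cc.retract α M x)‖ ≤ ‖tensorPermRep π (G ⧸ M) x‖ := by
  classical
  refine ContinuousLinearMap.opNorm_le_bound _ (norm_nonneg _) fun v => ?_
  rw [apply_retract_eq_tensorPermRep]
  refine (lp.norm_apply_le_norm two_ne_zero _ _).trans ((ContinuousLinearMap.le_opNorm _ _).trans ?_)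
  rw [lp.norm_single two_pos]

end Induced

theorem universalNorm_retract_le (M : Subgroup G) (x : Cc α) :
    (universalNorm α).toSeminorm (Cc.retract α M x) ≤ (universalNorm α).toSeminorm x :=
  sSup_repNorms_le (sSup_repNorms_nonneg x) fun _ _ _ _ π =>
    (norm_apply_retract_le π M x).trans (le_sSup_repNorms (tensorPermRep π (G ⧸ M)) x)

/-! ### The projections are contractive for the reduced norm -/

section Pinching

variable {X Q V : Type*} [NormedAddCommGroup V] [InnerProductSpace ℂ V]

open Classical in
/-- The restriction of the elements of `ℓ²(X, V)` to the fibre of `f` over `q`. -/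
def fibreProj (V : Type*) [NormedAddCommGroup V] [InnerProductSpace ℂ V] (f : X → Q) (q : Q) :
    L2 X V →L[ℂ] L2 X V :=
  lp.mapCLM 2 (fun s => if f s = q then ContinuousLinearMap.id ℂ V else 0) zero_le_one (fun s => by
    split_ifs
    · exact ContinuousLinearMap.norm_id_le
    · simp)

open Classical in
theorem fibreProj_apply (f : X → Q) (q : Q) (ξ : L2 X V) (s : X) :
    fibreProj V f q ξ s = if f s = q then ξ s else 0 := by
  rw [fibreProj, lp.mapCLM_apply_coe]
  split_ifs <;> rfl

theorem sum_norm_fibreProj [Fintype Q] (f : X → Q) (ξ : L2 X V) :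
    ∑ q, ‖fibreProj V f q ξ‖ ^ 2 = ‖ξ‖ ^ 2 := by
  classical
  have h : ∀ η : L2 X V, HasSum (fun s => ‖η s‖ ^ 2) (‖η‖ ^ 2) := fun η => by
    simpa using lp.hasSum_norm (p := 2) (by simp) η
  refine (hasSum_sum fun q _ => h (fibreProj V f q ξ)).unique ?_
  convert h ξ using 2 with s
  rw [Finset.sum_eq_single (f s)]
  · rw [fibreProj_apply, if_pos rfl]
  · intro q _ hq
    rw [fibreProj_apply, if_neg (Ne.symm hq)]
    simp
  · simp

theorem norm_fibreProj_le (f : X → Q) (q : Q) (ξ : L2 X V) : ‖fibreProj V f q ξ‖ ≤ ‖ξ‖ := by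
  classical
  refine lp.norm_mono two_ne_zero fun s => ?_
  rw [fibreProj_apply]
  split_ifs
  · exact le_rfl
  · simp

/-- The norm of the block diagonal part of an operator is at most the norm of the operator. -/
theorem norm_le_of_pinching [Finite Q] (f : X → Q) (T S : L2 X V →L[ℂ] L2 X V)
    (h : ∀ ξ s, S ξ s = T (fibreProj V f (f s) ξ) s) : ‖S‖ ≤ ‖T‖ := by
  classical
  have := Fintype.ofFinite Q
  refine ContinuousLinearMap.opNorm_le_bound _ T.opNorm_nonneg fun ξ => ?_
  refine le_of_sq_le_sq ?_ (by positivity)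
  have hq : ∀ q, fibreProj V f q (S ξ) = fibreProj V f q (T (fibreProj V f q ξ)) := fun q => by
    ext s
    rw [fibreProj_apply, fibreProj_apply]
    split_ifs with hs
    · rw [h, hs]
    · rfl
  rw [← sum_norm_fibreProj f, mul_pow, ← sum_norm_fibreProj f ξ, Finset.mul_sum]
  refine Finset.sum_le_sum fun q _ => ?_
  rw [hq, ← mul_pow]
  exact pow_le_pow_left₀ (norm_nonneg _) ((norm_fibreProj_le _ _ _).trans (T.le_opNorm _)) 2

end Pinching

section Reduced

variable {V : Type*} [NormedAddCommGroup V] [InnerProductSpace ℂ V] [CompleteSpace V]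
  (ρ : P →⋆ₐ[ℂ] (V →L[ℂ] V))

theorem regRep_single (g : G) (a : P) (ξ : L2 G V) (s : G) :
    regRep α ρ (Cc.single α g a) ξ s = ρ (α s⁻¹ a) (ξ (g⁻¹ * s)) := by
  rw [regRep, Cc.lift_single]
  simp [regPi, regLam_apply]

theorem reducedNorm_retract_le (M : Subgroup G) [M.FiniteIndex] (x : Cc α) :
    (reducedNorm α ρ).toSeminorm (Cc.retract α M x) ≤ (reducedNorm α ρ).toSeminorm x := by
  classical
  show ‖regRep α ρ (Cc.retract α M x)‖ ≤ ‖regRep α ρ x‖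
  refine norm_le_of_pinching (fun s : G => ((s⁻¹ : G) : G ⧸ M)) _ _ fun ξ s => ?_
  induction x using Cc.induction_on with
  | zero => simp
  | add x y hx hy => simp [hx, hy]
  | single g a =>
    have hg : (((g⁻¹ * s)⁻¹ : G) : G ⧸ M) = ((s⁻¹ : G) : G ⧸ M) ↔ g ∈ M := by
      rw [eq_comm, QuotientGroup.eq]
      simp
    rw [regRep_single, fibreProj_apply]
    by_cases h : g ∈ M
    · rw [Cc.retract_single_of_mem h, if_pos (hg.mpr h), regRep_single]
    · rw [Cc.retract_single_of_notMem h, if_neg (mt hg.mp h)]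
      simp

end Reduced

/-! ### The crossed products are nonzero -/

theorem nontrivial_L2 (X V : Type*) [Nonempty X] [NormedAddCommGroup V] [Nontrivial V] :
    Nontrivial (L2 X V) := by
  classical
  obtain ⟨v, hv⟩ := exists_ne (0 : V)
  refine ⟨⟨lp.single 2 (Classical.arbitrary X) v, 0, fun h => hv ?_⟩⟩
  rw [← norm_eq_zero, ← lp.norm_single (E := fun _ : X => V) two_pos (Classical.arbitrary X), h,
    norm_zero]

theorem nontrivial_compl_of_apply_one {p : CStarSeminorm (Cc α)} (h : p.toSeminorm 1 ≠ 0) :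
    Nontrivial p.Compl := by
  refine ⟨⟨1, 0, fun h1 => h ?_⟩⟩
  rw [← p.norm_toCompl, map_one, h1, norm_zero]

theorem nontrivial_compl_reducedNorm [Nontrivial P] {V : Type*} [NormedAddCommGroup V]
    [InnerProductSpace ℂ V] [CompleteSpace V] {ρ : P →⋆ₐ[ℂ] (V →L[ℂ] V)}
    (hρ : Function.Injective ρ) : Nontrivial (reducedNorm α ρ).Compl := by
  have : Nontrivial V := by
    by_contra hV
    have := not_nontrivial_iff_subsingleton.mp hV
    exact one_ne_zero (α := P) (hρ (by ext v; exact Subsingleton.elim _ _))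
  have := nontrivial_L2 G V
  refine nontrivial_compl_of_apply_one ?_
  show ‖regRep α ρ 1‖ ≠ 0
  rw [map_one, norm_one]
  exact one_ne_zero

theorem nontrivial_compl_universalNorm [Nontrivial P] : Nontrivial (universalNorm α).Compl := by
  obtain ⟨V, _, _, _, ρ, _⟩ := exists_nontrivial_rep P
  have := nontrivial_L2 G V
  refine nontrivial_compl_of_apply_one (ne_of_gt ?_)
  refine lt_of_lt_of_le ?_ (le_sSup_repNorms (regRep α ρ) 1)
  rw [map_one, norm_one]
  exact one_pos

end Crossed

end WatataniAngle

end

noncomputable section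

namespace WatataniAngle

/-! ### Compatible conditional expectations and the `A`-valued inner product -/

namespace CondExp

variable {A : Type*} [CStarAlgebra A] {B : StarSubalgebra ℂ A} {E : CondExp B}

theorem continuous_toMap (E : CondExp B) : Continuous E.toMap :=
  (E.toMap.mkContinuous 1 fun a => by rw [one_mul]; exact E.norm_map_le a).continuous

theorem compatible_unique (hE : E.HasFiniteIndex) {C : StarSubalgebra ℂ A} {F F' : CondExp C}
    (hF : ∀ a, E.toMap a = E.toMap (F.toMap a)) (hF' : ∀ a, E.toMap a = E.toMap (F'.toMap a)) :
    F.toMap = F'.toMap := by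
  have h : ∀ z ∈ C, ∀ a, E.toMap (z * F.toMap a) = E.toMap (z * F'.toMap a) := fun z hz a => by
    rw [← F.map_mul_left hz, ← F'.map_mul_left hz, ← hF, ← hF']
  ext a
  rw [(hE.isQuasiBasis (F.toMap a)).2, (hE.isQuasiBasis (F'.toMap a)).2]
  refine Finset.sum_congr rfl fun i _ => ?_
  rw [hF, F.map_mul_right (F.map_mem a), h _ (F.map_mem _), ← F.map_mul_right (F'.map_mem a), ← hF]

theorem jonesC_eq (hE : E.HasFiniteIndex) {C : StarSubalgebra ℂ A} (hC : E.IsIMS C) {F : CondExp C}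
    (hF : ∀ a, E.toMap a = E.toMap (F.toMap a)) : (jonesC hE hC).1 = F.toMap :=
  compatible_unique hE hC.2.2.choose_spec hF

theorem isAdjoint_compatible {C : StarSubalgebra ℂ A} {F : CondExp C}
    (hF : ∀ a, E.toMap a = E.toMap (F.toMap a)) : E.IsAdjoint F.toMap F.toMap := fun x y => by
  rw [hF, ← F.map_star, F.map_mul_left (F.map_mem _), ← F.map_mul_right (F.map_mem y), ← hF]

theorem isAdjoint_self (E : CondExp B) : E.IsAdjoint E.toMap E.toMap :=
  isAdjoint_compatible fun a => (E.map_of_mem _ (E.map_mem a)).symm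

theorem dualExp_eq (hE : E.HasFiniteIndex) {n : ℕ} {mu : Fin n → A} (hmu : E.IsQuasiBasis mu)
    (T : E.basicConstruction) :
    dualExp hE T = Ring.inverse (index hE) * ∑ j, T.1 (mu j) * star (mu j) := by
  show Ring.inverse (index hE) * _ = _
  congr 1
  obtain ⟨T, hT⟩ := T
  induction hT using Submodule.span_induction with
  | zero => simp
  | add S S' _ _ h h' =>
    simp only at h h'
    simp [add_mul, Finset.sum_add_distrib, h, h']
  | smul c S _ h =>
    simp only at h
    simp [← Finset.smul_sum, h]
  | mem S hS =>
    obtain ⟨x, y, rfl⟩ := hS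
    simp only [opE_apply, mul_assoc x]
    rw [← Finset.mul_sum, ← Finset.mul_sum, ← (hE.isQuasiBasis y).1, ← (hmu y).1]

theorem innerA_jones_sub (hE : E.HasFiniteIndex) {n : ℕ} {mu : Fin n → A}
    (hmu : E.IsQuasiBasis mu) {C D : StarSubalgebra ℂ A} (hC : E.IsIMS C) (hD : E.IsIMS D)
    {F : CondExp C} {F' : CondExp D} (hF : ∀ a, E.toMap a = E.toMap (F.toMap a))
    (hF' : ∀ a, E.toMap a = E.toMap (F'.toMap a)) :
    innerA hE (jonesC hE hC - E.jonesB) (jonesC hE hD - E.jonesB) = Ring.inverse (index hE) *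
      ∑ j, (F.toMap (F'.toMap (mu j)) - E.toMap (mu j)) * star (mu j) := by
  have hT : ((jonesC hE hC - E.jonesB : E.basicConstruction) : Module.End ℂ A)
      = F.toMap - E.toMap := by
    rw [Submodule.coe_sub, jonesC_eq hE hC hF]; rfl
  have hS : ((jonesC hE hD - E.jonesB : E.basicConstruction) : Module.End ℂ A)
      = F'.toMap - E.toMap := by
    rw [Submodule.coe_sub, jonesC_eq hE hD hF']; rfl
  have hadj : (adj (jonesC hE hC - E.jonesB)).1 = F.toMap - E.toMap := by
    refine IsAdjoint.unique hE (isAdjoint_adj _) ?_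
    rw [hT]
    intro x y
    simp only [LinearMap.sub_apply, star_sub, sub_mul, mul_sub, map_sub]
    rw [isAdjoint_compatible hF x y, isAdjoint_self E x y]
  rw [innerA, dualExp_eq hE hmu]
  refine congrArg _ (Finset.sum_congr rfl fun j _ => ?_)
  simp only [hadj, hS, Module.End.mul_apply, LinearMap.sub_apply, map_sub]
  rw [← hF', F.map_of_mem _ (hC.1 (E.map_mem _)), E.map_of_mem _ (E.map_mem _), sub_self, sub_zero]

end CondExp

section Crossed

variable {P : Type u} [CStarAlgebra P] {G : Type v} [Group G] {α : G →* (P ≃⋆ₐ[ℂ] P)}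
  {p : CStarSeminorm (Cc α)} {H : Subgroup G}

/-! ### The canonical conditional expectation has finite index -/

theorem IsCanonicalExp.map_toCompl {M : Subgroup G} {E : CondExp (subCrossed p M)}
    (hE : IsCanonicalExp p M E) (x : Cc α) :
    E.toMap (p.toCompl x) = p.toCompl (Cc.retract α M x) :=
  hE x

variable (p) in
/-- The canonical unitaries of the crossed product. -/
def crossedUnitary : G →* p.Compl := (p.toCompl : Cc α →* p.Compl).comp (Cc.unitary α)

theorem crossedUnitary_apply (g : G) : crossedUnitary p g = p.toCompl (Cc.unitary α g) := rfl

theorem star_crossedUnitary (g : G) : star (crossedUnitary p g) = crossedUnitary p g⁻¹ := by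
  rw [crossedUnitary_apply, ← map_star, Cc.star_unitary, crossedUnitary_apply]

theorem crossedUnitary_mul_star (g : G) : crossedUnitary p g * star (crossedUnitary p g) = 1 := by
  rw [star_crossedUnitary, ← map_mul, mul_inv_cancel, map_one]

theorem crossedUnitary_mem {M : Subgroup G} {g : G} (hg : g ∈ M) : crossedUnitary p g ∈ subCrossed p M :=
  toCompl_single_mem hg 1

open Classical in
theorem IsCanonicalExp.map_crossedUnitary {M : Subgroup G} {E : CondExp (subCrossed p M)}
    (hE : IsCanonicalExp p M E) (g : G) :
    E.toMap (crossedUnitary p g) = if g ∈ M then crossedUnitary p g else 0 := by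
  rw [crossedUnitary_apply, hE.map_toCompl, Cc.unitary_apply]
  split_ifs with h
  · rw [Cc.retract_single_of_mem h]
  · rw [Cc.retract_single_of_notMem h, map_zero]

theorem mem_of_crossedUnitary_mem [Nontrivial p.Compl] {M : Subgroup G} {E : CondExp (subCrossed p M)}
    (hE : IsCanonicalExp p M E) {g : G} (hg : crossedUnitary p g ∈ subCrossed p M) : g ∈ M := by
  classical
  by_contra h
  have h1 := E.map_of_mem _ hg
  rw [hE.map_crossedUnitary, if_neg h] at h1
  have h2 := crossedUnitary_mul_star (p := p) g
  rw [← h1, zero_mul] at h2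
  exact zero_ne_one h2

theorem Cc.sum_unitary_mul_retract [Fintype (G ⧸ H)] (x : Cc α) :
    ∑ q : G ⧸ H, Cc.unitary α q.out * Cc.retract α H (Cc.unitary α q.out⁻¹ * x) = x := by
  classical
  induction x using Cc.induction_on with
  | zero => simp
  | add x y hx hy => simp only [mul_add, map_add, Finset.sum_add_distrib, hx, hy]
  | single g a =>
    have hq : ∀ q : G ⧸ H, q.out⁻¹ * g ∈ H ↔ q = (g : G ⧸ H) := fun q => by
      rw [← QuotientGroup.eq, QuotientGroup.out_eq']
    rw [Finset.sum_eq_single (g : G ⧸ H)]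
    · rw [Cc.unitary_apply (_⁻¹), Cc.single_mul_single, Cc.retract_single_of_mem ((hq _).mpr rfl),
        ← Cc.single_mul_single, ← Cc.unitary_apply, ← mul_assoc, ← map_mul, mul_inv_cancel,
        map_one, one_mul]
    · intro q _ h
      rw [Cc.unitary_apply (_⁻¹), Cc.single_mul_single,
        Cc.retract_single_of_notMem (mt (hq q).mp h), mul_zero]
    · simp

variable (p H) in
/-- The quasi-basis given by representatives of the left cosets of `H`. -/
def cosetBasis [Finite (G ⧸ H)] (i : Fin (Nat.card (G ⧸ H))) : p.Compl :=
  crossedUnitary p ((Finite.equivFin (G ⧸ H)).symm i).out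

theorem IsCanonicalExp.isQuasiBasis_cosetBasis [Finite (G ⧸ H)] {E : CondExp (subCrossed p H)}
    (hE : IsCanonicalExp p H E) : E.IsQuasiBasis (cosetBasis p H) := by
  have := Fintype.ofFinite (G ⧸ H)
  have hr : ∀ x, ∑ i, cosetBasis p H i * E.toMap (star (cosetBasis p H i) * x) = x := by
    have hc := E.continuous_toMap
    refine eq_of_eq_on_toCompl (by fun_prop) continuous_id fun x => ?_
    conv_rhs => rw [← Cc.sum_unitary_mul_retract (H := H) x, map_sum]
    rw [← (Finite.equivFin (G ⧸ H)).symm.sum_comp]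
    refine Finset.sum_congr rfl fun i _ => ?_
    rw [map_mul p.toCompl, ← hE.map_toCompl, map_mul p.toCompl, ← crossedUnitary_apply, ← crossedUnitary_apply, ← star_crossedUnitary]
    rfl
  refine fun x => ⟨?_, (hr x).symm⟩
  apply star_injective
  conv_lhs => rw [← hr (star x)]
  simp only [star_sum, star_mul, star_star, ← E.map_star]

theorem IsCanonicalExp.hasFiniteIndex [Finite (G ⧸ H)] {E : CondExp (subCrossed p H)}
    (hE : IsCanonicalExp p H E) : E.HasFiniteIndex :=
  ⟨_, _, hE.isQuasiBasis_cosetBasis⟩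

theorem IsCanonicalExp.index_eq [Finite (G ⧸ H)] {E : CondExp (subCrossed p H)}
    (hE : IsCanonicalExp p H E) (hE' : E.HasFiniteIndex) :
    CondExp.index hE' = (Nat.card (G ⧸ H) : ℂ) • 1 := by
  rw [CondExp.index_eq hE' hE.isQuasiBasis_cosetBasis]
  simp [cosetBasis, crossedUnitary_mul_star, Algebra.smul_def]

theorem IsCanonicalExp.inverse_index [Finite (G ⧸ H)] {E : CondExp (subCrossed p H)}
    (hE : IsCanonicalExp p H E) (hE' : E.HasFiniteIndex) :
    Ring.inverse (CondExp.index hE') = (Nat.card (G ⧸ H) : ℂ)⁻¹ • 1 := by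
  have hn : (Nat.card (G ⧸ H) : ℂ) ≠ 0 := by exact_mod_cast Nat.card_pos.ne'
  rw [hE.index_eq]
  exact Ring.inverse_unit (⟨(Nat.card (G ⧸ H) : ℂ) • 1, (Nat.card (G ⧸ H) : ℂ)⁻¹ • 1,
    by simp [smul_smul, hn], by simp [smul_smul, hn]⟩ : p.Complˣ)

/-! ### Intermediate crossed products -/

theorem IsCanonicalExp.compatible {M : Subgroup G} (hHM : H ≤ M) {E : CondExp (subCrossed p H)}
    (hE : IsCanonicalExp p H E) {F : CondExp (subCrossed p M)} (hF : IsCanonicalExp p M F)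
    (a : p.Compl) : E.toMap a = E.toMap (F.toMap a) := by
  refine eq_of_eq_on_toCompl E.continuous_toMap
    (E.continuous_toMap.comp F.continuous_toMap) (fun x => ?_) a
  simp only [Function.comp_apply]
  rw [hF.map_toCompl, hE.map_toCompl, hE.map_toCompl, Cc.retract_retract hHM]

theorem IsCanonicalExp.isIMS {M : Subgroup G} (hHM : H ≤ M) {E : CondExp (subCrossed p H)}
    (hE : IsCanonicalExp p H E) {F : CondExp (subCrossed p M)} (hF : IsCanonicalExp p M F) :
    E.IsIMS (subCrossed p M) :=
  ⟨subCrossed_mono hHM, isClosed_subCrossed M, F, hE.compatible hHM hF⟩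

open Classical in
/-- The number of left cosets of `H` with representative in `M`. -/
def cosetCount [Fintype (G ⧸ H)] (M : Subgroup G) : ℕ :=
  (Finset.univ.filter fun q : G ⧸ H => q.out ∈ M).card

theorem cosetCount_mono [Fintype (G ⧸ H)] {M N : Subgroup G} (h : M ≤ N) :
    cosetCount (H := H) M ≤ cosetCount (H := H) N := by
  classical
  exact Finset.card_le_card (Finset.monotone_filter_right _ fun q _ hq => h hq)

theorem cosetCount_lt [Fintype (G ⧸ H)] {M N : Subgroup G} (hM : H ≤ M) (h : M < N) :
    cosetCount (H := H) M < cosetCount (H := H) N := by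
  classical
  obtain ⟨g, hgN, hgM⟩ := SetLike.exists_of_lt h
  obtain ⟨k, hk⟩ := QuotientGroup.mk_out_eq_mul H g
  refine Finset.card_lt_card ⟨Finset.monotone_filter_right _ fun q _ hq => h.le hq, fun hsub => ?_⟩
  have h1 := hsub (x := (g : G ⧸ H)) (by
    rw [Finset.mem_filter, hk]
    exact ⟨Finset.mem_univ _, N.mul_mem hgN (h.le (hM k.2))⟩)
  rw [Finset.mem_filter, hk, M.mul_mem_cancel_right (hM k.2)] at h1
  exact hgM h1.2

theorem eq_of_cosetCount_le [Fintype (G ⧸ H)] {M N : Subgroup G} (hM : H ≤ M) (h : M ≤ N)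
    (hc : cosetCount (H := H) N ≤ cosetCount (H := H) M) : M = N := by
  by_contra hne
  exact absurd (cosetCount_lt hM (lt_of_le_of_ne h hne)) hc.not_gt

theorem norm_innerA_jones_sub [Fintype (G ⧸ H)] [Nontrivial p.Compl]
    {E : CondExp (subCrossed p H)} (hE : IsCanonicalExp p H E) (hE' : E.HasFiniteIndex)
    {M N : Subgroup G} (hHM : H ≤ M) (hHN : H ≤ N)
    {F : CondExp (subCrossed p M)} (hF : IsCanonicalExp p M F)
    {F' : CondExp (subCrossed p N)} (hF' : IsCanonicalExp p N F')
    (hC : E.IsIMS (subCrossed p M)) (hD : E.IsIMS (subCrossed p N)) :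
    ‖CondExp.innerA hE' (CondExp.jonesC hE' hC - E.jonesB) (CondExp.jonesC hE' hD - E.jonesB)‖
      = ((cosetCount (H := H) (M ⊓ N) : ℝ) - cosetCount (H := H) H) / Nat.card (G ⧸ H) := by
  classical
  have hterm : ∀ g : G, (F.toMap (F'.toMap (crossedUnitary p g)) - E.toMap (crossedUnitary p g)) *
      star (crossedUnitary p g) = (if g ∈ M ⊓ N then 1 else 0) - (if g ∈ H then 1 else 0) := fun g => by
    rw [hF'.map_crossedUnitary, hE.map_crossedUnitary, apply_ite F.toMap, map_zero, hF.map_crossedUnitary, sub_mul,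
      ite_mul, ite_mul, ite_mul, zero_mul, crossedUnitary_mul_star, Subgroup.mem_inf]
    by_cases h1 : g ∈ M <;> by_cases h2 : g ∈ N <;> simp [h1, h2]
  have hsum : ∑ i, (F.toMap (F'.toMap (cosetBasis p H i)) - E.toMap (cosetBasis p H i)) *
      star (cosetBasis p H i)
      = (((cosetCount (H := H) (M ⊓ N) : ℝ) - cosetCount (H := H) H : ℝ) : ℂ) • 1 := by
    refine ((Finite.equivFin (G ⧸ H)).symm.sum_comp (fun q : G ⧸ H => (F.toMap (F'.toMap
      (crossedUnitary p q.out)) - E.toMap (crossedUnitary p q.out)) * star (crossedUnitary p q.out))).trans ?_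
    simp only [hterm, Finset.sum_sub_distrib, Finset.sum_boole, cosetCount]
    push_cast
    rw [sub_smul, Nat.cast_smul_eq_nsmul, Nat.cast_smul_eq_nsmul, nsmul_one, nsmul_one]
  have h0 : (0 : ℝ) ≤ (cosetCount (H := H) (M ⊓ N) : ℝ) - cosetCount (H := H) H :=
    sub_nonneg.mpr (by exact_mod_cast cosetCount_mono (le_inf hHM hHN))
  rw [CondExp.innerA_jones_sub hE' hE.isQuasiBasis_cosetBasis hC hD (hE.compatible hHM hF)
    (hE.compatible hHN hF'), hsum, hE.inverse_index, smul_mul_smul_comm, mul_one, norm_smul,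
    norm_one, mul_one, norm_mul, norm_inv, Complex.norm_natCast, Complex.norm_real,
    Real.norm_of_nonneg h0, div_eq_inv_mul]

theorem angle_arithmetic {x y z : ℝ} (hx : 0 ≤ x) (hxy : x ≤ y) (hxz : x ≤ z) (hy : 0 < y)
    (hz : 0 < z) : (Real.arccos (x / (√y * √z)) = Real.pi / 2 ↔ x = 0) ∧
      (Real.arccos (x / (√y * √z)) = 0 ↔ x = y ∧ x = z) := by
  have h0 : 0 < √y * √z := mul_pos (Real.sqrt_pos.mpr hy) (Real.sqrt_pos.mpr hz)
  rw [Real.arccos_eq_pi_div_two, Real.arccos_eq_zero, div_eq_zero_iff, or_iff_left h0.ne',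
    one_le_div h0]
  refine ⟨Iff.rfl, fun h => ?_, ?_⟩
  · rw [← Real.sqrt_mul hy.le, Real.sqrt_le_left hx] at h
    constructor <;> nlinarith
  · rintro ⟨rfl, rfl⟩
    exact (Real.mul_self_sqrt hx).le

/-- The angle between two intermediate crossed products determines whether the subgroups meet in
`H`, and whether they coincide. -/
theorem interiorAngle_subCrossed [Finite (G ⧸ H)] [Nontrivial p.Compl]
    {E : CondExp (subCrossed p H)} (hE : IsCanonicalExp p H E) (hE' : E.HasFiniteIndex)
    {M N : Subgroup G} (hHM : H < M) (hHN : H < N)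
    {F : CondExp (subCrossed p M)} (hF : IsCanonicalExp p M F)
    {F' : CondExp (subCrossed p N)} (hF' : IsCanonicalExp p N F')
    (hC : E.IsIMS (subCrossed p M)) (hD : E.IsIMS (subCrossed p N)) :
    (CondExp.interiorAngle hE' hC hD = Real.pi / 2 ↔ M ⊓ N = H) ∧
      (CondExp.interiorAngle hE' hC hD = 0 ↔ M = N) := by
  have := Fintype.ofFinite (G ⧸ H)
  have hn : (0 : ℝ) < Nat.card (G ⧸ H) := by exact_mod_cast Nat.card_pos
  have hinf : H ≤ M ⊓ N := le_inf hHM.le hHN.le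
  have hMN := norm_innerA_jones_sub hE hE' hHM.le hHN.le hF hF' hC hD
  have hMM := norm_innerA_jones_sub hE hE' hHM.le hHM.le hF hF hC hC
  have hNN := norm_innerA_jones_sub hE hE' hHN.le hHN.le hF' hF' hD hD
  rw [inf_idem] at hMM hNN
  have h0 : (cosetCount (H := H) H : ℝ) ≤ cosetCount (H := H) (M ⊓ N) := by
    exact_mod_cast cosetCount_mono hinf
  have h1 : (cosetCount (H := H) (M ⊓ N) : ℝ) ≤ cosetCount (H := H) M := by
    exact_mod_cast cosetCount_mono inf_le_left
  have h2 : (cosetCount (H := H) (M ⊓ N) : ℝ) ≤ cosetCount (H := H) N := by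
    exact_mod_cast cosetCount_mono inf_le_right
  have h3 : (cosetCount (H := H) H : ℝ) < cosetCount (H := H) M := by
    exact_mod_cast cosetCount_lt le_rfl hHM
  have h4 : (cosetCount (H := H) H : ℝ) < cosetCount (H := H) N := by
    exact_mod_cast cosetCount_lt le_rfl hHN
  rw [CondExp.interiorAngle, CondExp.normA, CondExp.normA, hMN, hMM, hNN]
  obtain ⟨ha, hb⟩ := angle_arithmetic (div_nonneg (sub_nonneg.mpr h0) hn.le)
    (div_le_div_of_nonneg_right (sub_le_sub_right h1 _) hn.le)
    (div_le_div_of_nonneg_right (sub_le_sub_right h2 _) hn.le)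
    (div_pos (sub_pos.mpr h3) hn) (div_pos (sub_pos.mpr h4) hn)
  rw [ha, hb, div_left_inj' hn.ne', div_left_inj' hn.ne', sub_left_inj, sub_left_inj,
    div_eq_zero_iff, or_iff_left hn.ne', sub_eq_zero, Nat.cast_inj, Nat.cast_inj, Nat.cast_inj]
  refine ⟨⟨fun h => (eq_of_cosetCount_le le_rfl hinf h.le).symm, fun h => by rw [h]⟩,
    fun h => ?_, ?_⟩
  · rw [← eq_of_cosetCount_le hinf inf_le_left h.1.ge]
    exact eq_of_cosetCount_le hinf inf_le_right h.2.ge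
  · rintro rfl
    simp

theorem normal_iff_forall_map_conj_inv (K : Subgroup G) :
    (∀ g : G, K.map (MulAut.conj g⁻¹).toMonoidHom = K) ↔ K.Normal :=
  inv_surjective.forall.symm.trans Subgroup.normal_iff_map_conj_eq.symm

theorem exists_isCanonicalExp
    (hp : (∃ (V : Type w) (_ : NormedAddCommGroup V) (_ : InnerProductSpace ℂ V)
        (_ : CompleteSpace V) (ρ : P →⋆ₐ[ℂ] (V →L[ℂ] V)),
        Function.Injective ρ ∧ p = reducedNorm α ρ) ∨ p = universalNorm α)
    (M : Subgroup G) [M.FiniteIndex] : ∃ F : CondExp (subCrossed p M), IsCanonicalExp p M F := by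
  obtain ⟨V, _, _, _, ρ, -, rfl⟩ | rfl := hp
  · exact ⟨_, isCanonicalExp_canonicalExp (reducedNorm_retract_le ρ M)⟩
  · exact ⟨_, isCanonicalExp_canonicalExp (universalNorm_retract_le M)⟩

theorem nontrivial_compl [Nontrivial P]
    (hp : (∃ (V : Type w) (_ : NormedAddCommGroup V) (_ : InnerProductSpace ℂ V)
        (_ : CompleteSpace V) (ρ : P →⋆ₐ[ℂ] (V →L[ℂ] V)),
        Function.Injective ρ ∧ p = reducedNorm α ρ) ∨ p = universalNorm α) :
    Nontrivial p.Compl := by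
  obtain ⟨V, _, _, _, ρ, hρ, rfl⟩ | rfl := hp
  · exact nontrivial_compl_reducedNorm hρ
  · exact nontrivial_compl_universalNorm

/-- Inclusions of crossed products by subgroups come from inclusions of the subgroups. -/
theorem le_of_subCrossed_le [Nontrivial p.Compl] {M N : Subgroup G} {F : CondExp (subCrossed p N)}
    (hF : IsCanonicalExp p N F) (h : subCrossed p M ≤ subCrossed p N) : M ≤ N :=
  fun _ hg => mem_of_crossedUnitary_mem hF (h (crossedUnitary_mem hg))

end Crossed

end WatataniAngle

end

open WatataniAngle in
theorem mainTheorem5 {P : Type u} [CStarAlgebra P] [Nontrivial P] {G : Type v} [Group G]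
    [Countable G] (α : G →* (P ≃⋆ₐ[ℂ] P)) (p : WatataniAngle.CStarSeminorm (WatataniAngle.Cc α))
    (hp : (∃ (V : Type w) (_ : NormedAddCommGroup V) (_ : InnerProductSpace ℂ V)
        (_ : CompleteSpace V) (ρ : P →⋆ₐ[ℂ] (V →L[ℂ] V)),
        Function.Injective ρ ∧ p = WatataniAngle.reducedNorm α ρ) ∨
      p = WatataniAngle.universalNorm α)
    (H K L : Subgroup G) (hfin : H.FiniteIndex)
    (hHK : H < K) (hKG : K < ⊤) (hHL : H < L) (hLG : L < ⊤) :
    (∃ E : WatataniAngle.CondExp (WatataniAngle.subCrossed p H),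
      WatataniAngle.IsCanonicalExp p H E) ∧
    ∀ E : WatataniAngle.CondExp (WatataniAngle.subCrossed p H),
      WatataniAngle.IsCanonicalExp p H E →
      ∃ (hE : E.HasFiniteIndex)
        (hC : E.IsIMS (WatataniAngle.subCrossed p K))
        (hD : E.IsIMS (WatataniAngle.subCrossed p L)),
        WatataniAngle.subCrossed p K ≠ WatataniAngle.subCrossed p H ∧
        WatataniAngle.subCrossed p L ≠ WatataniAngle.subCrossed p H ∧
        (WatataniAngle.CondExp.interiorAngle hE hC hD = Real.pi / 2 ↔ K ⊓ L = H) ∧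
        (WatataniAngle.CondExp.interiorAngle hE hC hD = 0 ↔ K = L) ∧
        ((∀ g : G, ∃ hCg : E.IsIMS
            (WatataniAngle.subCrossed p (K.map (MulAut.conj g⁻¹).toMonoidHom)),
            WatataniAngle.subCrossed p (K.map (MulAut.conj g⁻¹).toMonoidHom) ≠
              WatataniAngle.subCrossed p H ∧
            WatataniAngle.CondExp.interiorAngle hE hC hCg = 0) ↔ K.Normal) := by
  have := nontrivial_compl hp
  have hexp := fun (M : Subgroup G) (hM : M.FiniteIndex) => exists_isCanonicalExp hp M
  refine ⟨hexp H hfin, fun E hE => ?_⟩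
  have hK : K.FiniteIndex := Subgroup.finiteIndex_of_le hHK.le
  have hL : L.FiniteIndex := Subgroup.finiteIndex_of_le hHL.le
  obtain ⟨F, hF⟩ := hexp K hK
  obtain ⟨F', hF'⟩ := hexp L hL
  have hE' := hE.hasFiniteIndex
  have hC := hE.isIMS hHK.le hF
  have hD := hE.isIMS hHL.le hF'
  have hne : ∀ M, H < M → subCrossed p M ≠ subCrossed p H := fun M hM h =>
    hM.not_ge (le_of_subCrossed_le hE h.le)
  refine ⟨hE', hC, hD, hne K hHK, hne L hHL,
    (interiorAngle_subCrossed hE hE' hHK hHL hF hF' hC hD).1,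
    (interiorAngle_subCrossed hE hE' hHK hHL hF hF' hC hD).2, ?_⟩
  rw [← normal_iff_forall_map_conj_inv]
  refine forall_congr' fun g => ?_
  constructor
  · rintro ⟨hCg, hCg', h⟩
    obtain ⟨F'', hF''⟩ := hexp (K.map (MulAut.conj g⁻¹).toMonoidHom)
      ⟨by rw [Subgroup.index_map_of_bijective (MulAut.conj g⁻¹).bijective]; exact hK.index_ne_zero⟩
    have hlt : H < K.map (MulAut.conj g⁻¹).toMonoidHom :=
      lt_of_le_of_ne (le_of_subCrossed_le hF'' hCg.1) fun he => hCg' (by rw [← he])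
    exact ((interiorAngle_subCrossed hE hE' hHK hlt hF hF'' hC hCg).2.mp h).symm
  · intro h
    rw [h]
    exact ⟨hC, hne K hHK, (interiorAngle_subCrossed hE hE' hHK hHK hF hF hC hC).2.mpr rfl⟩
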